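/- Let $\Omega\subset\mathbb R^2$ be a convex domain (a nonempty, bounded, open, convex set) having two orthogonal axes of symmetry. Denote by $|\Omega|$ its area, by $P(\Omega)=\mathcal H^1(\partial\Omega)$ its perimeter, by $w(\Omega)=\min_{\nu\in\mathbb S^1}\mathcal H^1(p_\nu(\Omega))$ its minimal width, where $p_\nu$ is the orthogonal projection onto the line $\mathbb R\nu$, and by $$\mu_1(\Omega)=\inf\left\{\frac{\int_\Omega|\nabla u|^2\,dx}{\int_\Omega u^2\,dx}\;:\;u\in H^1(\Omega)\setminus\{0\},\ \int_\Omega u\,dx=0\right\}$$ its first nontrivial Neumann eigenvalue. Then $$P(\Omega)\,w(\Omega)\le 4|\Omega|\qquad\text{and}\qquad P(\Omega)^2\mu_1(\Omega)\le 16\pi^2 .$$ Moreover, if $P(\Omega)^2\mu_1(\Omega)=16\pi^2$, then $\Omega$ is a square. -/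

import Mathlib

open MeasureTheory
open scoped ENNReal ContDiff

noncomputable section

/-- The Euclidean plane. -/
abbrev Plane : Type := EuclideanSpace ℝ (Fin 2)

/-- A planar convex domain: a nonempty, open, bounded, convex subset of the plane. -/
structure IsConvexDomain (Ω : Set Plane) : Prop where
  nonempty : Ω.Nonempty
  isOpen : IsOpen Ω
  isBounded : Bornology.IsBounded Ω
  convex : Convex ℝ Ω

/-- The line `L` is an axis of symmetry of `Ω`. -/
def IsSymmetryAxis (L : AffineSubspace ℝ Plane) (Ω : Set Plane) : Prop :=
  Module.finrank ℝ L.direction = 1 ∧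
    ∃ _ : Nonempty L, EuclideanGeometry.reflection L '' Ω = Ω

/-- The perimeter: the one-dimensional Hausdorff measure of the boundary. -/
def perimeter (Ω : Set Plane) : ℝ≥0∞ :=
  Measure.hausdorffMeasure 1 (frontier Ω)

/-- The minimal width: the infimum, over unit vectors `ν`, of the one-dimensional Hausdorff measure
of the orthogonal projection of `Ω` onto the line spanned by `ν`. -/
def minimalWidth (Ω : Set Plane) : ℝ≥0∞ :=
  ⨅ ν ∈ Metric.sphere (0 : Plane) 1,
    Measure.hausdorffMeasure 1 ((Submodule.span ℝ {ν}).starProjection '' Ω)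

/-- The vector field `g` is the weak gradient of `u` in `Ω` (tested against smooth functions
with compact support contained in `Ω`). -/
def IsWeakGradient (Ω : Set Plane) (u : Plane → ℝ) (g : Plane → Plane) : Prop :=
  ∀ φ : Plane → ℝ, ContDiff ℝ ∞ φ → HasCompactSupport φ → tsupport φ ⊆ Ω →
    ∀ v : Plane, ∫ x in Ω, u x * fderiv ℝ φ x v = - ∫ x in Ω, inner ℝ (g x) v * φ x

/-- The function `u` belongs to the Sobolev space `H¹(Ω)`, with weak gradient `g`. -/
structure IsSobolevPair (Ω : Set Plane) (u : Plane → ℝ) (g : Plane → Plane) : Prop where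
  memLp : MemLp u 2 (volume.restrict Ω)
  memLp_gradient : MemLp g 2 (volume.restrict Ω)
  isWeakGradient : IsWeakGradient Ω u g

/-- The first nontrivial Neumann eigenvalue of the Laplacian: the infimum of the Rayleigh quotient
over the nonzero functions of `H¹(Ω)` with zero mean. -/
def neumannMu1 (Ω : Set Plane) : ℝ≥0∞ :=
  sInf {r : ℝ≥0∞ | ∃ (u : Plane → ℝ) (g : Plane → Plane), IsSobolevPair Ω u g ∧
    ∫ x in Ω, u x = 0 ∧ ¬ u =ᵐ[volume.restrict Ω] 0 ∧
    r = (∫⁻ x in Ω, ‖g x‖ₑ ^ 2) / (∫⁻ x in Ω, ‖u x‖ₑ ^ 2)}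

/-- An open square: centre `c`, side `2 * s`, sides parallel to the orthonormal basis `b`. -/
def IsOpenSquare (Ω : Set Plane) : Prop :=
  ∃ (c : Plane) (b : OrthonormalBasis (Fin 2) ℝ Plane) (s : ℝ), 0 < s ∧
    Ω = {x | ∀ i, |inner ℝ (b i) (x - c)| < s}

end

/-!
The proof rests on the inradius `r` of `Ω` about its centre `c`, the intersection of the two axes.

A set with two orthogonal axes of symmetry is symmetric about `c`. If `z` is a point of the
complement of `Ω` closest to `c`, at distance `r`, then a line separating `z` from `Ω`, together
with its reflection in `c`, confines `Ω` to a strip of width at most `2 * r`, whereas the ball of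
radius `r` about `c` lies in `Ω` and has width `2 * r` in every direction. Hence the minimal width
is `2 * r`, and it is attained (`exists_ball_subset_and_strip`).

Since `Ω` contains this ball, it is a union of triangles with apex `c`, base on the boundary and
height at least `r`, so that `P ≤ 2 |Ω| / r` (`perimeter_le_of_ball_subset`); this is `P w ≤ 4 |Ω|`.
For the perimeter defined as a Hausdorff measure, the boundary is cut by thin cones with apex `c`.
The diameter of each piece is the length of a chord `pq`, the triangle `cpq` lies in the part of
`closure Ω` in that cone, and a short chord has distance almost `r` from `c` (`chord_bounds`), so
the diameters sum to at most `2 |Ω| / ρ` for any `ρ < r`.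

Finally `μ₁ ≤ π² w² / |Ω|²` for every convex domain in a strip of width `w`
(`neumannMu1_le_of_strip`). Let `ℓ t ≤ w` be the length of the section of `Ω` across the strip at
the position `t` along it, and let `F` be the primitive of `ℓ`, which increases from `0` to `|Ω|`.
The test function `cos (π F / |Ω|)` has mean zero, and the substitution `y = F t` bounds its
Rayleigh quotient by `π² w² / |Ω|²`, with equality only if `ℓ = w` on the whole projection, that is,
if `Ω` is a rectangle of width `w`. Multiplying this bound by the square of the bound for `P` gives
`P² μ₁ ≤ 16 π²`. In the equality case `Ω` is a rectangle with sides `a ≥ w` and `w` such that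
`P w = 4 |Ω|`, whence `4 a = P ≤ 2 (a + w)` and `a = w`.
-/

open Filter Topology Set

/-! ### Orthonormal coordinates and the area of a triangle -/

theorem measurePreserving_orthonormalCoords (b : OrthonormalBasis (Fin 2) ℝ Plane) :
    MeasurePreserving (fun x : Plane => ((inner ℝ (b 0) x : ℝ), (inner ℝ (b 1) x : ℝ)))
      volume volume := by
  have h := (volume_preserving_finTwoArrow ℝ).comp
    ((PiLp.volume_preserving_ofLp (Fin 2)).comp b.measurePreserving_repr)
  convert h using 2 with x
  simp [MeasurableEquiv.finTwoArrow, b.repr_apply_apply]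

theorem measurePreserving_coords :
    MeasurePreserving (fun x : Plane => (x 0, x 1)) volume volume := by
  simpa [EuclideanSpace.inner_single_left] using
    measurePreserving_orthonormalCoords (EuclideanSpace.basisFun (Fin 2) ℝ)

/-- The cross product of two plane vectors, which is twice the signed area of the triangle that
they span together with the origin. -/
def cross (p q : Plane) : ℝ := p 0 * q 1 - p 1 * q 0

theorem norm_sq_eq_coords (x : Plane) : ‖x‖ ^ 2 = x 0 ^ 2 + x 1 ^ 2 := by
  rw [EuclideanSpace.real_norm_sq_eq, Fin.sum_univ_two]

theorem inner_eq_coords (x y : Plane) : (inner ℝ x y : ℝ) = x 0 * y 0 + x 1 * y 1 := by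
  rw [PiLp.inner_apply, Fin.sum_univ_two]
  simp [mul_comm]

theorem volume_standardTriangle :
    volume {x : Plane | 0 < x 0 ∧ 0 < x 1 ∧ x 0 + x 1 < 1} = ENNReal.ofReal (1 / 2) := by
  have h1 : {x : Plane | 0 < x 0 ∧ 0 < x 1 ∧ x 0 + x 1 < 1} =
      (fun x : Plane => (x 0, x 1)) ⁻¹'
        regionBetween (fun _ => 0) (fun t : ℝ => 1 - t) (Ioc 0 1) := by
    ext x
    simp only [regionBetween, mem_ofPred_eq, mem_preimage, mem_Ioc, mem_Ioo]
    constructor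
    · rintro ⟨h0, h1, h2⟩
      exact ⟨⟨h0, by linarith⟩, h1, by linarith⟩
    · rintro ⟨⟨h0, -⟩, h1, h2⟩
      exact ⟨h0, h1, by linarith⟩
  have hm : MeasurableSet (regionBetween (fun _ => 0) (fun t : ℝ => 1 - t) (Ioc 0 1)) :=
    measurableSet_regionBetween measurable_const (by fun_prop) measurableSet_Ioc
  rw [h1, measurePreserving_coords.measure_preimage hm.nullMeasurableSet, Measure.volume_eq_prod,
    volume_regionBetween_eq_integral (by simp) ?_ measurableSet_Ioc ?_]
  · congr 1
    rw [← intervalIntegral.integral_of_le zero_le_one]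
    simp only [Pi.sub_apply, sub_zero]
    rw [intervalIntegral.integral_sub (by simp) (by simp), integral_id]
    norm_num
  · exact ((continuous_const.sub continuous_id).integrableOn_Icc).mono_set Ioc_subset_Icc_self
  · intro x hx
    linarith [hx.2]

/-- The triangle with vertices `0`, `p`, `q` has area `|cross p q| / 2`. -/
theorem ofReal_abs_cross_le_volume (p q : Plane) {T : Set Plane}
    (hT : ∀ s t : ℝ, 0 < s → 0 < t → s + t < 1 → s • p + t • q ∈ T) :
    ENNReal.ofReal |cross p q| ≤ 2 * volume T := by
  let B := (EuclideanSpace.basisFun (Fin 2) ℝ).toBasis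
  let f : Plane →ₗ[ℝ] Plane := Matrix.toLin B B !![p 0, q 0; p 1, q 1]
  have hdet : LinearMap.det f = cross p q := by
    rw [LinearMap.det_toLin, Matrix.det_fin_two_of, cross]
    ring
  have hf : ∀ x : Plane, f x = x 0 • p + x 1 • q := by
    intro x
    have hx : x = x 0 • B 0 + x 1 • B 1 := by
      ext i
      fin_cases i <;> simp [B]
    conv_lhs => rw [hx, map_add, map_smul, map_smul]
    congr 2
    · ext i
      simp only [f, Matrix.toLin_self]
      fin_cases i <;> simp [B]
    · ext i
      simp only [f, Matrix.toLin_self]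
      fin_cases i <;> simp [B]
  have hvol := Measure.addHaar_image_linearMap volume f
    {x : Plane | 0 < x 0 ∧ 0 < x 1 ∧ x 0 + x 1 < 1}
  rw [hdet, volume_standardTriangle] at hvol
  have hsub : f '' {x : Plane | 0 < x 0 ∧ 0 < x 1 ∧ x 0 + x 1 < 1} ⊆ T := by
    rintro _ ⟨x, ⟨h0, h1, h2⟩, rfl⟩
    rw [hf]
    exact hT _ _ h0 h1 h2
  calc ENNReal.ofReal |cross p q|
      = 2 * (ENNReal.ofReal |cross p q| * ENNReal.ofReal (1 / 2)) := by
        rw [mul_left_comm, ← ENNReal.ofReal_ofNat 2, ← ENNReal.ofReal_mul (by norm_num)]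
        norm_num
    _ ≤ 2 * volume T := by
        rw [← hvol]
        gcongr

/-! ### Chords of a convex set containing a ball -/

/-- If the foot `m` of the perpendicular from the origin to the line `pq` lies in `Ω`, then `p` does
not lie on the segment from `m` to `q`, since that segment is contained in `Ω` up to its end `q`.
As `⟪p, p - q⟫ ≤ 0` would put `p` there, `⟪p, p - q⟫ > 0`. -/
theorem inner_lt_of_foot_mem {Ω : Set Plane} (hc : Convex ℝ Ω) (ho : IsOpen Ω) {p q : Plane}
    (hp : p ∉ Ω) (hq : q ∈ closure Ω) (hpq : 0 < ‖p - q‖ ^ 2)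
    (hm : p + ((‖p‖ ^ 2 - inner ℝ p q) / ‖p - q‖ ^ 2) • (q - p) ∈ Ω) :
    (inner ℝ p q : ℝ) < ‖p‖ ^ 2 := by
  by_contra! hcon
  set s := (‖p‖ ^ 2 - inner ℝ p q) / ‖p - q‖ ^ 2
  have hs : s ≤ 0 := div_nonpos_of_nonpos_of_nonneg (by linarith) hpq.le
  have ht : (1 / (1 - s)) ∈ Ioc (0 : ℝ) 1 :=
    ⟨by apply one_div_pos.2; linarith, by rw [div_le_one (by linarith)]; linarith⟩
  have h := hc.add_smul_sub_mem_interior' hq (ho.interior_eq.symm ▸ hm) ht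
  rw [ho.interior_eq] at h
  apply hp
  convert h using 1
  have : (1 - s) ≠ 0 := by linarith
  have h2 : p + s • (q - p) - q = (1 - s) • (p - q) := by module
  rw [h2, smul_smul, one_div_mul_cancel this]
  module

/-- Let `r` be the radius of a ball centred at the origin and contained in `Ω`. A short chord `pq`
of the boundary of `Ω` has distance almost `r` to the origin, so that its length is almost at most
`|cross p q| / r`; the second bound provides the shortness. -/
theorem chord_bounds {Ω : Set Plane} (hc : Convex ℝ Ω) (ho : IsOpen Ω) {r : ℝ} (hr : 0 < r)
    (hball : Metric.ball 0 r ⊆ Ω) {p q : Plane} (hp : p ∈ frontier Ω) (hq : q ∈ frontier Ω) :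
    ‖p - q‖ ^ 2 * (r ^ 2 - ‖p - q‖ ^ 2 / 4) ≤ cross p q ^ 2 ∧
      (0 ≤ (inner ℝ p q : ℝ) → r ^ 2 * ‖p - q‖ ^ 2 ≤ 2 * cross p q ^ 2) := by
  rw [ho.frontier_eq] at hp hq
  have hout : ∀ x : Plane, x ∉ Ω → r ^ 2 ≤ ‖x‖ ^ 2 := by
    intro x hx
    have : r ≤ ‖x‖ := by
      by_contra! h
      exact hx (hball (by simpa using h))
    gcongr
  have ha := hout p hp.2
  have hb := hout q hq.2
  have hD : ‖p - q‖ ^ 2 = ‖p‖ ^ 2 + ‖q‖ ^ 2 - 2 * inner ℝ p q := by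
    rw [norm_sub_sq_real]; ring
  have hC : cross p q ^ 2 = ‖p‖ ^ 2 * ‖q‖ ^ 2 - (inner ℝ p q : ℝ) ^ 2 := by
    rw [norm_sq_eq_coords, norm_sq_eq_coords, inner_eq_coords, cross]; ring
  rcases (sq_nonneg ‖p - q‖).eq_or_lt with h0 | hpos
  · rw [← h0]
    exact ⟨by nlinarith [sq_nonneg (cross p q)], fun _ => by nlinarith [sq_nonneg (cross p q)]⟩
  set s := (‖p‖ ^ 2 - inner ℝ p q) / ‖p - q‖ ^ 2 with hs
  have hsD : s * ‖p - q‖ ^ 2 = ‖p‖ ^ 2 - inner ℝ p q := div_mul_cancel₀ _ hpos.ne'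
  have hm : ‖p + s • (q - p)‖ ^ 2 * ‖p - q‖ ^ 2 = cross p q ^ 2 := by
    rw [norm_add_sq_real, norm_smul, inner_smul_right, inner_sub_right,
      real_inner_self_eq_norm_sq, norm_sub_rev q p, mul_pow, Real.norm_eq_abs, sq_abs]
    have : (‖p‖ ^ 2 + 2 * (s * (inner ℝ p q - ‖p‖ ^ 2)) + s ^ 2 * ‖p - q‖ ^ 2) * ‖p - q‖ ^ 2
      = ‖p‖ ^ 2 * ‖p - q‖ ^ 2 + 2 * (s * ‖p - q‖ ^ 2) * (inner ℝ p q - ‖p‖ ^ 2)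
        + (s * ‖p - q‖ ^ 2) ^ 2 := by ring
    rw [this, hsD, hC, hD]
    ring
  rcases le_or_gt r ‖p + s • (q - p)‖ with hfar | hnear
  · have h1 : r ^ 2 * ‖p - q‖ ^ 2 ≤ cross p q ^ 2 := by
      rw [← hm]
      gcongr
    exact ⟨by nlinarith, fun _ => by nlinarith [sq_nonneg (cross p q)]⟩
  · have hmem : p + s • (q - p) ∈ Ω := hball (by simpa using hnear)
    have hx := inner_lt_of_foot_mem hc ho hp.2 hq.1 hpos hmem
    have hy := inner_lt_of_foot_mem hc ho (p := q) (q := p) hq.2 hp.1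
      (by rwa [norm_sub_rev]) (by
        convert hmem using 1
        have h3 : (‖q‖ ^ 2 - inner ℝ q p) / ‖q - p‖ ^ 2 = 1 - s := by
          rw [hs, norm_sub_rev q p, real_inner_comm p q, eq_sub_iff_add_eq, ← add_div,
            div_eq_one_iff_eq hpos.ne', hD]
          ring
        rw [h3]
        module)
    rw [real_inner_comm] at hy
    -- In terms of `x = ‖p‖² - ⟪p, q⟫` and `y = ‖q‖² - ⟪p, q⟫`, both bounds are polynomial.
    obtain ⟨x, hx'⟩ : ∃ x, x = ‖p‖ ^ 2 - inner ℝ p q := ⟨_, rfl⟩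
    obtain ⟨y, hy'⟩ : ∃ y, y = ‖q‖ ^ 2 - inner ℝ p q := ⟨_, rfl⟩
    obtain ⟨c, hc'⟩ : ∃ c : ℝ, c = inner ℝ p q := ⟨_, rfl⟩
    rw [hC, hD]
    rw [← hc'] at hx hy hx' hy' ⊢
    have hpx : ‖p‖ ^ 2 = x + c := by linarith
    have hqy : ‖q‖ ^ 2 = y + c := by linarith
    rw [hpx] at ha hx ⊢
    rw [hqy] at hb hy ⊢
    have hxy : 0 < x + y := by linarith
    constructor
    · rcases le_total x y with h | h
      · nlinarith [mul_le_mul_of_nonneg_left ha hxy.le, mul_nonneg hxy.le (sub_nonneg.2 h)]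
      · nlinarith [mul_le_mul_of_nonneg_left hb hxy.le, mul_nonneg hxy.le (sub_nonneg.2 h)]
    · intro h0
      rcases le_total x y with h | h
      · nlinarith [mul_le_mul_of_nonneg_left ha hxy.le, mul_nonneg hxy.le h0,
          mul_nonneg (show 0 ≤ x by linarith) (sub_nonneg.2 h)]
      · nlinarith [mul_le_mul_of_nonneg_left hb hxy.le, mul_nonneg hxy.le h0,
          mul_nonneg (show 0 ≤ y by linarith) (sub_nonneg.2 h)]

/-! ### The perimeter of a convex set containing a ball -/

/-- The half-open cone of the points `x` in the half-plane `0 < σ * x 0` whose slope `x 1 / x 0`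
lies in the interval `[k / n, (k + 1) / n)`. -/
def slopeCone (σ : ℝ) (n : ℕ) (k : ℤ) : Set Plane :=
  {x | 0 < σ * x 0 ∧ k * (σ * x 0) ≤ n * (σ * x 1) ∧ n * (σ * x 1) < (k + 1) * (σ * x 0)}

theorem measurableSet_slopeCone (σ : ℝ) (n : ℕ) (k : ℤ) : MeasurableSet (slopeCone σ n k) := by
  have h0 : Measurable fun x : Plane => σ * x 0 := by fun_prop
  have h1 : Measurable fun x : Plane => n * (σ * x 1) := by fun_prop
  exact (measurableSet_lt measurable_const h0).inter
    ((measurableSet_le (h0.const_mul _) h1).inter (measurableSet_lt h1 (h0.const_mul _)))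

theorem pairwise_disjoint_slopeCone (σ : ℝ) (n : ℕ) :
    Pairwise (Function.onFun Disjoint (slopeCone σ n)) := by
  intro k l hkl
  refine Set.disjoint_left.2 fun x hk hl => hkl ?_
  have h1 : (k : ℝ) < l + 1 := lt_of_mul_lt_mul_right (hk.2.1.trans_lt hl.2.2) hk.1.le
  have h2 : (l : ℝ) < k + 1 := lt_of_mul_lt_mul_right (hl.2.1.trans_lt hk.2.2) hk.1.le
  have h3 : k < l + 1 := by exact_mod_cast h1
  have h4 : l < k + 1 := by exact_mod_cast h2
  omega

theorem iUnion_slopeCone (σ : ℝ) (n : ℕ) : ⋃ k, slopeCone σ n k = {x | 0 < σ * x 0} := by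
  refine Subset.antisymm (iUnion_subset fun k x hx => hx.1) fun x (hx : 0 < σ * x 0) => ?_
  refine mem_iUnion.2 ⟨⌊n * (σ * x 1) / (σ * x 0)⌋, hx, ?_, ?_⟩
  · exact (le_div_iff₀ hx).1 (Int.floor_le _)
  · exact (div_lt_iff₀ hx).1 (Int.lt_floor_add_one _)

theorem slopeCone_combination {σ : ℝ} {n : ℕ} {k : ℤ} {p q : Plane} (hp : p ∈ slopeCone σ n k)
    (hq : q ∈ slopeCone σ n k) {s t : ℝ} (hs : 0 < s) (ht : 0 < t) :
    s • p + t • q ∈ slopeCone σ n k := by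
  obtain ⟨p1, p2, p3⟩ := hp
  obtain ⟨q1, q2, q3⟩ := hq
  refine ⟨?_, ?_, ?_⟩ <;> simp only [PiLp.add_apply, PiLp.smul_apply, smul_eq_mul]
  · have := mul_pos hs p1
    have := mul_pos ht q1
    linarith
  · have := mul_le_mul_of_nonneg_left p2 hs.le
    have := mul_le_mul_of_nonneg_left q2 ht.le
    linarith
  · have := mul_lt_mul_of_pos_left p3 hs
    have := mul_lt_mul_of_pos_left q3 ht
    linarith

theorem inner_nonneg_of_mem_slopeCone {σ : ℝ} (hσ : σ ^ 2 = 1) {n : ℕ} (hn : 0 < n) {k : ℤ}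
    {p q : Plane} (hp : p ∈ slopeCone σ n k) (hq : q ∈ slopeCone σ n k) :
    0 ≤ (inner ℝ p q : ℝ) := by
  obtain ⟨p1, p2, p3⟩ := hp
  obtain ⟨q1, q2, q3⟩ := hq
  have hn' : (0 : ℝ) < n := by exact_mod_cast hn
  have h1 : (inner ℝ p q : ℝ) = (σ * p 0) * (σ * q 0) + (σ * p 1) * (σ * q 1) := by
    rw [inner_eq_coords]
    linear_combination (-(p 0 * q 0 + p 1 * q 1)) * hσ
  rw [h1]
  refine add_nonneg (mul_nonneg p1.le q1.le) ?_
  -- The slopes of `p` and `q` have the same sign, because the cones do not straddle slope `0`.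
  rcases le_or_gt 0 k with hk | hk
  · have hk' : (0 : ℝ) ≤ k := by exact_mod_cast hk
    exact mul_nonneg
      (nonneg_of_mul_nonneg_right ((mul_nonneg hk' p1.le).trans p2) hn')
      (nonneg_of_mul_nonneg_right ((mul_nonneg hk' q1.le).trans q2) hn')
  · have hk' : (k : ℝ) + 1 ≤ 0 := by exact_mod_cast hk
    exact mul_nonneg_of_nonpos_of_nonpos
      (nonpos_of_mul_nonpos_right (p3.le.trans (mul_nonpos_of_nonpos_of_nonneg hk' p1.le)) hn')
      (nonpos_of_mul_nonpos_right (q3.le.trans (mul_nonpos_of_nonpos_of_nonneg hk' q1.le)) hn')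

theorem abs_cross_le_of_mem_slopeCone {σ : ℝ} (hσ : σ ^ 2 = 1) {n : ℕ} {k : ℤ}
    {p q : Plane} (hp : p ∈ slopeCone σ n k) (hq : q ∈ slopeCone σ n k) :
    n * |cross p q| ≤ ‖p‖ * ‖q‖ := by
  have hle : ∀ x : Plane, |σ * x 0| ≤ ‖x‖ := by
    intro x
    refine abs_le_of_sq_le_sq ?_ (norm_nonneg x)
    rw [norm_sq_eq_coords, mul_pow, hσ]
    nlinarith [sq_nonneg (x 1)]
  have h1 := (le_abs_self _).trans (hle p)
  have h2 := (le_abs_self _).trans (hle q)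
  obtain ⟨p1, p2, p3⟩ := hp
  obtain ⟨q1, q2, q3⟩ := hq
  refine le_trans ?_ (mul_le_mul h1 h2 q1.le (norm_nonneg p))
  rw [← abs_of_nonneg (Nat.cast_nonneg (α := ℝ) n), ← abs_mul]
  have h3 : n * cross p q = (σ * p 0) * (n * (σ * q 1)) - (n * (σ * p 1)) * (σ * q 0) := by
    rw [cross]
    linear_combination (-(n * (p 0 * q 1 - p 1 * q 0))) * hσ
  rw [h3, abs_le]
  constructor
  · nlinarith [mul_le_mul_of_nonneg_left q2 p1.le, mul_le_mul_of_nonneg_right p3.le q1.le]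
  · nlinarith [mul_le_mul_of_nonneg_right p2 q1.le, mul_le_mul_of_nonneg_left q3.le p1.le]

/-- The part of the boundary in one of the cones has diameter at most `2 / ρ` times the area of the
part of `Ω` in that cone, because any chord spans a triangle with the origin. -/
theorem ediam_frontier_inter_slopeCone_le {Ω : Set Plane} (hc : Convex ℝ Ω) {r : ℝ} (hr : 0 < r)
    (hball : Metric.ball 0 r ⊆ Ω) {ρ : ℝ} (hρ : 0 < ρ) {σ : ℝ} {n : ℕ} {k : ℤ}
    (hchord : ∀ p ∈ frontier Ω ∩ slopeCone σ n k, ∀ q ∈ frontier Ω ∩ slopeCone σ n k,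
      ρ ^ 2 * ‖p - q‖ ^ 2 ≤ cross p q ^ 2) :
    Metric.ediam (frontier Ω ∩ slopeCone σ n k) ≤
      ENNReal.ofReal (2 / ρ) * volume (closure Ω ∩ slopeCone σ n k) := by
  refine Metric.ediam_le fun p hp q hq => ?_
  have h0 : (0 : Plane) ∈ closure Ω := subset_closure (hball (by simpa using hr))
  have harea := ofReal_abs_cross_le_volume p q (T := closure Ω ∩ slopeCone σ n k) (by
    intro s t hs ht hst
    refine ⟨?_, slopeCone_combination hp.2 hq.2 hs ht⟩
    have := hc.closure.sum_mem (t := Finset.univ) (w := ![1 - s - t, s, t]) (z := ![0, p, q])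
      (by intro i _; fin_cases i <;> simp <;> linarith)
      (by simp only [Fin.sum_univ_three, Matrix.cons_val]; ring)
      (by
        intro i _
        fin_cases i
        · exact h0
        · exact frontier_subset_closure hp.1
        · exact frontier_subset_closure hq.1)
    simpa [Fin.sum_univ_three] using this)
  have hlen : ‖p - q‖ ≤ ρ⁻¹ * |cross p q| := by
    rw [le_inv_mul_iff₀ hρ]
    refine (sq_le_sq₀ (by positivity) (abs_nonneg _)).1 ?_
    rw [mul_pow, sq_abs]
    exact hchord p hp q hq
  calc edist p q = ENNReal.ofReal ‖p - q‖ := by rw [edist_dist, dist_eq_norm]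
    _ ≤ ENNReal.ofReal ρ⁻¹ * ENNReal.ofReal |cross p q| := by
        rw [← ENNReal.ofReal_mul (by positivity)]
        exact ENNReal.ofReal_le_ofReal hlen
    _ ≤ ENNReal.ofReal ρ⁻¹ * (2 * volume (closure Ω ∩ slopeCone σ n k)) := by gcongr
    _ = _ := by
        rw [← mul_assoc, mul_comm _ 2, div_eq_mul_inv, ENNReal.ofReal_mul zero_le_two,
          ENNReal.ofReal_ofNat]

/-- The half of the boundary in `0 < σ * x 0` is covered by the cones of slopes `[k / n, (k + 1) / n)`
as `n → ∞`. The second bound of `chord_bounds` makes the pieces uniformly small, after which the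
first one makes `ρ` a lower bound for the distance of their chords to the origin. -/
theorem hausdorffMeasure_frontier_halfPlane_le {Ω : Set Plane} (hΩ : IsConvexDomain Ω) {r : ℝ}
    (hr : 0 < r) (hball : Metric.ball 0 r ⊆ Ω) {ρ : ℝ} (hρ : 0 < ρ) (hρr : ρ < r) {σ : ℝ}
    (hσ : σ ^ 2 = 1) :
    Measure.hausdorffMeasure 1 (frontier Ω ∩ {x | 0 < σ * x 0}) ≤
      ENNReal.ofReal (2 / ρ) * volume (closure Ω ∩ {x | 0 < σ * x 0}) := by
  obtain ⟨R, hR⟩ := hΩ.isBounded.closure.exists_norm_le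
  have hcross : ∀ n : ℕ, 0 < n → ∀ k, ∀ p ∈ frontier Ω ∩ slopeCone σ n k,
      ∀ q ∈ frontier Ω ∩ slopeCone σ n k, |cross p q| ≤ R ^ 2 / n := by
    intro n hn k p hp q hq
    rw [le_div_iff₀ (by exact_mod_cast hn), mul_comm]
    refine (abs_cross_le_of_mem_slopeCone hσ hp.2 hq.2).trans ?_
    rw [sq]
    have hp' := hR p (frontier_subset_closure hp.1)
    have hq' := hR q (frontier_subset_closure hq.1)
    exact mul_le_mul hp' hq' (norm_nonneg _) ((norm_nonneg _).trans hp')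
  have hshort : ∀ n : ℕ, 0 < n → ∀ k, ∀ p ∈ frontier Ω ∩ slopeCone σ n k,
      ∀ q ∈ frontier Ω ∩ slopeCone σ n k, ‖p - q‖ ^ 2 ≤ 2 * (R ^ 2 / n / r) ^ 2 := by
    intro n hn k p hp q hq
    have h1 := (chord_bounds hΩ.convex hΩ.isOpen hr hball hp.1 hq.1).2
      (inner_nonneg_of_mem_slopeCone hσ hn hp.2 hq.2)
    have h2 : cross p q ^ 2 ≤ (R ^ 2 / n) ^ 2 := sq_le_sq' (abs_le.1 (hcross n hn k p hp q hq)).1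
      (abs_le.1 (hcross n hn k p hp q hq)).2
    rw [div_pow _ r, ← mul_div_assoc, le_div_iff₀ (by positivity)]
    linarith
  have hlim : Tendsto (fun n : ℕ => 2 * (R ^ 2 / n / r)) atTop (𝓝 0) := by
    simpa using ((tendsto_const_div_atTop_nhds_zero_nat (R ^ 2)).div_const r).const_mul 2
  have hlim' : Tendsto (fun n : ℕ => 2 * (R ^ 2 / n / r) ^ 2 / 4) atTop (𝓝 0) := by
    simpa using (((((tendsto_const_div_atTop_nhds_zero_nat (R ^ 2)).div_const r).pow 2).const_mul
      2).div_const 4)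
  have hchord : ∀ᶠ n : ℕ in atTop, ∀ k, ∀ p ∈ frontier Ω ∩ slopeCone σ n k,
      ∀ q ∈ frontier Ω ∩ slopeCone σ n k, ρ ^ 2 * ‖p - q‖ ^ 2 ≤ cross p q ^ 2 := by
    have hgap : 0 < r ^ 2 - ρ ^ 2 := by nlinarith
    filter_upwards [hlim'.eventually_lt_const hgap, eventually_gt_atTop 0] with n h1 hn k p hp q hq
    have h2 := (chord_bounds hΩ.convex hΩ.isOpen hr hball hp.1 hq.1).1
    have h3 := hshort n hn k p hp q hq
    refine le_trans ?_ h2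
    rw [mul_comm]
    exact mul_le_mul_of_nonneg_left (by linarith) (sq_nonneg _)
  have hmeas := Measure.hausdorffMeasure_le_liminf_tsum (X := Plane) 1
    (frontier Ω ∩ {x | 0 < σ * x 0}) (l := atTop)
    (fun n : ℕ => ENNReal.ofReal (2 * (R ^ 2 / n / r)))
    (by simpa using ENNReal.tendsto_ofReal hlim)
    (fun n (k : ℤ) => frontier Ω ∩ slopeCone σ n k)
    (by
      filter_upwards [eventually_gt_atTop 0] with n hn k
      refine Metric.ediam_le fun p hp q hq => ?_
      rw [edist_dist, dist_eq_norm]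
      refine ENNReal.ofReal_le_ofReal ?_
      refine (sq_le_sq₀ (by positivity) (by positivity)).1 ?_
      nlinarith [hshort n hn k p hp q hq, sq_nonneg (R ^ 2 / n / r)])
    (by
      refine Eventually.of_forall fun n => ?_
      rw [← inter_iUnion, iUnion_slopeCone])
  refine hmeas.trans ?_
  refine (liminf_le_liminf (v := fun _ => ENNReal.ofReal (2 / ρ) *
    volume (closure Ω ∩ {x | 0 < σ * x 0})) ?_).trans_eq (liminf_const _)
  filter_upwards [hchord] with n hn
  rw [← iUnion_slopeCone σ n, inter_iUnion, measure_iUnion, ← ENNReal.tsum_mul_left]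
  · refine ENNReal.tsum_le_tsum fun k => ?_
    rw [ENNReal.rpow_one]
    exact ediam_frontier_inter_slopeCone_le hΩ.convex hr hball hρ (hn k)
  · exact fun k l hkl => (pairwise_disjoint_slopeCone σ n hkl).mono inter_subset_right
      inter_subset_right
  · exact fun k => isClosed_closure.measurableSet.inter (measurableSet_slopeCone σ n k)

/-- The boundary of `Ω` meets the line `x 0 = 0` in at most two points, one for each sign of
`x 1`. -/
theorem subsingleton_frontier_inter_ray {Ω : Set Plane} (hΩ : IsConvexDomain Ω) {r : ℝ}
    (hr : 0 < r) (hball : Metric.ball 0 r ⊆ Ω) {σ : ℝ} (hσ : σ ^ 2 = 1) :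
    (frontier Ω ∩ {x : Plane | x 0 = 0 ∧ 0 ≤ σ * x 1}).Subsingleton := by
  rintro p ⟨hp, hp0, hp1⟩ q ⟨hq, hq0, hq1⟩
  have hinner : 0 ≤ (inner ℝ p q : ℝ) := by
    rw [inner_eq_coords, hp0]
    have := mul_nonneg hp1 hq1
    have h2 : σ * p 1 * (σ * q 1) = p 1 * q 1 := by linear_combination (p 1 * q 1) * hσ
    linarith
  have h := (chord_bounds hΩ.convex hΩ.isOpen hr hball hp hq).2 hinner
  have hz : cross p q = 0 := by rw [cross, hp0, hq0]; ring
  rw [hz] at h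
  have h3 : ‖p - q‖ ^ 2 ≤ 0 := by
    by_contra! hcon
    have : 0 < r ^ 2 * ‖p - q‖ ^ 2 := by positivity
    linarith
  exact sub_eq_zero.1 (norm_eq_zero.1 (pow_eq_zero_iff two_ne_zero |>.1
    (le_antisymm h3 (sq_nonneg _))))

theorem perimeter_le_of_ball_zero_subset {Ω : Set Plane} (hΩ : IsConvexDomain Ω) {r : ℝ}
    (hr : 0 < r) (hball : Metric.ball 0 r ⊆ Ω) :
    perimeter Ω ≤ ENNReal.ofReal (2 / r) * volume Ω := by
  have hvol : volume (closure Ω) = volume Ω := by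
    refine le_antisymm ?_ (measure_mono subset_closure)
    rw [closure_eq_self_union_frontier]
    refine (measure_union_le _ _).trans_eq ?_
    rw [hΩ.convex.addHaar_frontier volume, add_zero]
  have hρ : ∀ ρ, 0 < ρ → ρ < r → perimeter Ω ≤ ENNReal.ofReal (2 / ρ) * volume Ω := by
    intro ρ h0 h1
    have hpos := hausdorffMeasure_frontier_halfPlane_le hΩ hr hball h0 h1 (σ := 1) (by norm_num)
    have hneg := hausdorffMeasure_frontier_halfPlane_le hΩ hr hball h0 h1 (σ := -1) (by norm_num)
    have := Measure.nullSingletonClass_hausdorff Plane one_pos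
    have hray := (subsingleton_frontier_inter_ray hΩ hr hball (σ := 1) (by norm_num)).measure_zero
      (Measure.hausdorffMeasure 1)
    have hray' := (subsingleton_frontier_inter_ray hΩ hr hball (σ := -1)
      (by norm_num)).measure_zero (Measure.hausdorffMeasure 1)
    have hcover : frontier Ω ⊆ (frontier Ω ∩ {x : Plane | 0 < 1 * x 0} ∪
        frontier Ω ∩ {x : Plane | 0 < -1 * x 0}) ∪
        (frontier Ω ∩ {x : Plane | x 0 = 0 ∧ 0 ≤ 1 * x 1} ∪
          frontier Ω ∩ {x : Plane | x 0 = 0 ∧ 0 ≤ -1 * x 1}) := by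
      intro x hx
      simp only [mem_union, mem_inter_iff, mem_ofPred_eq, hx, true_and]
      rcases lt_trichotomy (x 0) 0 with h | h | h
      · exact Or.inl (Or.inr (by linarith))
      · refine Or.inr ?_
        rcases le_total 0 (x 1) with h' | h'
        · exact Or.inl ⟨h, by linarith⟩
        · exact Or.inr ⟨h, by linarith⟩
      · exact Or.inl (Or.inl (by linarith))
    have hdisj : Disjoint (closure Ω ∩ {x : Plane | 0 < 1 * x 0})
        (closure Ω ∩ {x : Plane | 0 < -1 * x 0}) := by
      refine Set.disjoint_left.2 fun x hx hx' => ?_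
      have h1 : 0 < 1 * x 0 := hx.2
      have h2 : 0 < -1 * x 0 := hx'.2
      linarith
    have hmeas : MeasurableSet (closure Ω ∩ {x : Plane | 0 < -1 * x 0}) := by
      have h0 : Measurable fun x : Plane => -1 * x 0 := by fun_prop
      exact isClosed_closure.measurableSet.inter (measurableSet_lt measurable_const h0)
    calc perimeter Ω ≤ _ := measure_mono hcover
      _ ≤ _ := measure_union_le _ _
      _ ≤ _ := add_le_add (measure_union_le _ _) (measure_union_le _ _)
      _ ≤ ENNReal.ofReal (2 / ρ) * volume (closure Ω ∩ {x : Plane | 0 < 1 * x 0}) +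
          ENNReal.ofReal (2 / ρ) * volume (closure Ω ∩ {x : Plane | 0 < -1 * x 0}) := by
        rw [hray, hray', add_zero, add_zero]
        exact add_le_add hpos hneg
      _ = ENNReal.ofReal (2 / ρ) * volume (closure Ω ∩ {x : Plane | 0 < 1 * x 0} ∪
          closure Ω ∩ {x : Plane | 0 < -1 * x 0}) := by
        rw [measure_union hdisj hmeas, mul_add]
      _ ≤ ENNReal.ofReal (2 / ρ) * volume Ω := by
        rw [← hvol]
        gcongr
        exact union_subset inter_subset_left inter_subset_left
  have hlim : Tendsto (fun ρ => ENNReal.ofReal (2 / ρ) * volume Ω) (𝓝[<] r)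
      (𝓝 (ENNReal.ofReal (2 / r) * volume Ω)) := by
    refine ENNReal.Tendsto.mul_const ?_ (Or.inr hΩ.isBounded.measure_lt_top.ne)
    refine ENNReal.tendsto_ofReal ?_
    exact ((continuousAt_const.div continuousAt_id hr.ne').tendsto).mono_left nhdsWithin_le_nhds
  refine ge_of_tendsto hlim ?_
  filter_upwards [Ioo_mem_nhdsLT hr] with ρ h using hρ ρ h.1 h.2

/-- A convex domain that contains a ball of radius `r` has perimeter at most `2 / r` times its
area: it is a union of triangles with apex at the centre of the ball, base on the boundary and
height at least `r`. -/
theorem perimeter_le_of_ball_subset {Ω : Set Plane} (hΩ : IsConvexDomain Ω) {c : Plane} {r : ℝ}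
    (hr : 0 < r) (hball : Metric.ball c r ⊆ Ω) :
    perimeter Ω ≤ ENNReal.ofReal (2 / r) * volume Ω := by
  have hΩ' : IsConvexDomain ((fun x => c + x) ⁻¹' Ω) :=
    { nonempty := hΩ.nonempty.preimage (add_left_surjective c)
      isOpen := hΩ.isOpen.preimage (continuous_const_add c)
      isBounded := (IsometryEquiv.addLeft c).symm.isometry.lipschitz.isBounded_image hΩ.isBounded
        |>.subset (by
          rw [IsometryEquiv.image_symm]
          rfl)
      convex := hΩ.convex.translate_preimage_right c }
  have h := perimeter_le_of_ball_zero_subset hΩ' hr (by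
    intro x hx
    apply hball
    simpa using hx)
  rw [measure_preimage_add] at h
  have hper : perimeter ((fun x => c + x) ⁻¹' Ω) = perimeter Ω := by
    unfold perimeter
    rw [show (fun x => c + x) ⁻¹' Ω = (Homeomorph.addLeft c) ⁻¹' Ω from rfl,
      ← Homeomorph.preimage_frontier]
    exact (IsometryEquiv.addLeft c).hausdorffMeasure_preimage 1 _
  rwa [hper] at h

/-! ### Central symmetry and the minimal width -/

/-- A plane set with two orthogonal axes of symmetry is symmetric about their intersection, because
the product of the two reflections is the point reflection. -/
theorem exists_center_of_orthogonal_axes {Ω : Set Plane} {L₁ L₂ : AffineSubspace ℝ Plane}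
    (h₁ : IsSymmetryAxis L₁ Ω) (h₂ : IsSymmetryAxis L₂ Ω) (hL : L₁.direction ⟂ L₂.direction) :
    ∃ c : Plane, ∀ x ∈ Ω, (2 : ℝ) • c - x ∈ Ω := by
  obtain ⟨hd₁, hn₁, hr₁⟩ := h₁
  obtain ⟨hd₂, hn₂, hr₂⟩ := h₂
  have hdir : L₂.direction = L₁.directionᗮ := by
    refine Submodule.eq_of_le_of_finrank_eq hL.symm.le ?_
    have := L₁.direction.finrank_add_finrank_orthogonal
    rw [finrank_euclideanSpace_fin] at this
    omega
  obtain ⟨c, hc₁, hc₂⟩ := AffineSubspace.inter_nonempty_of_nonempty_of_sup_direction_eq_top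
    (s₁ := L₁) (s₂ := L₂) (nonempty_coe_sort.1 hn₁) (nonempty_coe_sort.1 hn₂)
    (by rw [hdir]; exact Submodule.sup_orthogonal_of_hasOrthogonalProjection)
  refine ⟨c, fun x hx => ?_⟩
  have h1 : EuclideanGeometry.reflection L₁ x ∈ Ω := hr₁ ▸ mem_image_of_mem _ hx
  have h2 : EuclideanGeometry.reflection L₂ (EuclideanGeometry.reflection L₁ x) ∈ Ω :=
    hr₂ ▸ mem_image_of_mem _ h1
  convert h2 using 1
  rw [EuclideanGeometry.reflection_apply_of_mem L₁ x hc₁,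
    EuclideanGeometry.reflection_apply_of_mem L₂ _ hc₂]
  simp only [hdir, vsub_eq_sub, vadd_eq_add, add_sub_cancel_right,
    Submodule.reflection_orthogonal_apply, Submodule.reflection_reflection]
  module

theorem hausdorffMeasure_smul_Ioo {ν : Plane} (hν : ‖ν‖ = 1) (a b : ℝ) :
    Measure.hausdorffMeasure 1 ((fun t : ℝ => t • ν) '' Ioo a b) = ENNReal.ofReal (b - a) := by
  have hiso : Isometry fun t : ℝ => t • ν := by
    refine Isometry.of_dist_eq fun s t => ?_
    rw [dist_eq_norm, ← sub_smul, norm_smul, hν, mul_one, Real.dist_eq, Real.norm_eq_abs]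
  rw [hiso.hausdorffMeasure_image (Or.inl zero_le_one), hausdorffMeasure_real, Real.volume_Ioo]

/-- For a centrally symmetric convex domain, the largest ball around the centre touches the
boundary at a point whose supporting line, together with its reflection, bounds a strip of minimal
width. -/
theorem exists_ball_subset_and_strip {Ω : Set Plane} (hΩ : IsConvexDomain Ω) {c : Plane}
    (hsymm : ∀ x ∈ Ω, (2 : ℝ) • c - x ∈ Ω) :
    ∃ r : ℝ, 0 < r ∧ Metric.ball c r ⊆ Ω ∧ minimalWidth Ω = ENNReal.ofReal (2 * r) ∧
      ∃ ν : Plane, ‖ν‖ = 1 ∧ ∀ x ∈ Ω, inner ℝ ν x ∈ Ioo (inner ℝ ν c - r) (inner ℝ ν c + r) := by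
  have hc : c ∈ Ω := by
    obtain ⟨x, hx⟩ := hΩ.nonempty
    have := hΩ.convex hx (hsymm x hx) (a := 1 / 2) (b := 1 / 2) (by norm_num) (by norm_num)
      (by norm_num)
    convert this using 1
    module
  have hne : Ωᶜ.Nonempty := by
    rw [nonempty_compl]
    rintro rfl
    exact NormedSpace.unbounded_univ ℝ Plane hΩ.isBounded
  obtain ⟨z, hz, hzr⟩ := hΩ.isOpen.isClosed_compl.exists_infDist_eq_dist hne c
  have hzc : 0 < dist c z := dist_pos.2 fun h => hz (h ▸ hc)
  have hball : Metric.ball c (dist c z) ⊆ Ω := by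
    intro x hx
    by_contra hcon
    have h1 := Metric.infDist_le_dist_of_mem (x := c) (show x ∈ Ωᶜ from hcon)
    rw [Metric.mem_ball, dist_comm] at hx
    linarith
  have hstrip : ∃ ν : Plane, ‖ν‖ = 1 ∧
      ∀ x ∈ Ω, inner ℝ ν x ∈ Ioo (inner ℝ ν c - dist c z) (inner ℝ ν c + dist c z) := by
    obtain ⟨f, hf⟩ := geometric_hahn_banach_open_point hΩ.convex hΩ.isOpen hz
    obtain ⟨w, hw⟩ : ∃ w : Plane, ∀ x, f x = inner ℝ w x :=
      ⟨(InnerProductSpace.toDual ℝ Plane).symm f, fun x => by simp⟩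
    simp only [hw] at hf
    have hw0 : 0 < ‖w‖ := norm_pos_iff.2 fun h => by simpa [h] using hf c hc
    have hupper : ∀ x ∈ Ω, inner ℝ w (x - c) < ‖w‖ * dist c z := by
      intro x hx
      calc inner ℝ w (x - c) < inner ℝ w (z - c) := by
            rw [inner_sub_right, inner_sub_right]
            linarith [hf x hx]
        _ ≤ ‖w‖ * ‖z - c‖ := real_inner_le_norm _ _
        _ = _ := by rw [dist_comm, dist_eq_norm]
    refine ⟨‖w‖⁻¹ • w, by rw [norm_smul, norm_inv, norm_norm, inv_mul_cancel₀ hw0.ne'], ?_⟩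
    have hupper' : ∀ x ∈ Ω, inner ℝ (‖w‖⁻¹ • w) (x - c) < dist c z := by
      intro x hx
      rw [real_inner_smul_left, inv_mul_lt_iff₀ hw0]
      exact hupper x hx
    intro x hx
    have h1 := hupper' x hx
    have h2 := hupper' _ (hsymm x hx)
    have h3 : (2 : ℝ) • c - x - c = -(x - c) := by module
    rw [h3, inner_neg_right] at h2
    rw [inner_sub_right] at h1 h2
    constructor <;> linarith
  refine ⟨dist c z, hzc, hball, ?_, hstrip⟩
  have hproj : ∀ ν : Plane, ‖ν‖ = 1 → ∀ x,
      (Submodule.span ℝ {ν}).starProjection x = (inner ℝ ν x : ℝ) • ν := fun ν hν x =>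
    Submodule.starProjection_unit_singleton ℝ hν x
  apply le_antisymm
  · obtain ⟨ν, hν, hstrip⟩ := hstrip
    refine (iInf₂_le ν (by simpa using hν)).trans ?_
    refine (measure_mono (t := (fun t : ℝ => t • ν) ''
      Ioo (inner ℝ ν c - dist c z) (inner ℝ ν c + dist c z)) ?_).trans_eq ?_
    · rintro _ ⟨x, hx, rfl⟩
      rw [hproj ν hν]
      exact mem_image_of_mem _ (hstrip x hx)
    · rw [hausdorffMeasure_smul_Ioo hν]
      congr 1
      ring
  · refine le_iInf₂ fun ν hν => ?_
    rw [mem_sphere_zero_iff_norm] at hν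
    have h : ENNReal.ofReal (2 * dist c z) = Measure.hausdorffMeasure 1 ((fun t : ℝ => t • ν) ''
        Ioo (inner ℝ ν c - dist c z) (inner ℝ ν c + dist c z)) := by
      rw [hausdorffMeasure_smul_Ioo hν]
      congr 1
      ring
    rw [h]
    refine measure_mono ?_
    rintro _ ⟨t, ht, rfl⟩
    refine ⟨c + (t - inner ℝ ν c) • ν, hball ?_, ?_⟩
    · rw [Metric.mem_ball, dist_eq_norm, add_sub_cancel_left, norm_smul, hν, mul_one,
        Real.norm_eq_abs, abs_lt]
      constructor <;> linarith [ht.1, ht.2]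
    · rw [hproj ν hν, inner_add_right, inner_smul_right, real_inner_self_eq_norm_sq, hν]
      congr 1
      ring

/-! ### Rectangles -/

/-- The product `I × J` in the coordinates given by the orthonormal basis `b`; for open intervals
`I` and `J` this is an open rectangle with sides parallel to `b`. -/
def rectangle (b : OrthonormalBasis (Fin 2) ℝ Plane) (I J : Set ℝ) : Set Plane :=
  {x | inner ℝ (b 0) x ∈ I ∧ inner ℝ (b 1) x ∈ J}

theorem eq_inner_smul_add (b : OrthonormalBasis (Fin 2) ℝ Plane) (x : Plane) :
    x = (inner ℝ (b 0) x : ℝ) • b 0 + (inner ℝ (b 1) x : ℝ) • b 1 := by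
  conv_lhs => rw [← b.sum_repr' x, Fin.sum_univ_two]

theorem inner_basis_smul_add (b : OrthonormalBasis (Fin 2) ℝ Plane) (s t : ℝ) :
    inner ℝ (b 0) (s • b 0 + t • b 1) = s ∧ inner ℝ (b 1) (s • b 0 + t • b 1) = t := by
  have h := orthonormal_iff_ite.1 b.orthonormal
  simp [inner_add_right, inner_smul_right, h]

theorem volume_rectangle (b : OrthonormalBasis (Fin 2) ℝ Plane) (α β γ δ : ℝ) :
    volume (rectangle b (Ioo α β) (Ioo γ δ)) =
      ENNReal.ofReal (β - α) * ENNReal.ofReal (δ - γ) := by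
  have h := (measurePreserving_orthonormalCoords b).measure_preimage
    (measurableSet_Ioo.prod measurableSet_Ioo : MeasurableSet (Ioo α β ×ˢ Ioo γ δ)).nullMeasurableSet
  rw [Measure.volume_eq_prod, Measure.prod_prod, Real.volume_Ioo, Real.volume_Ioo] at h
  exact h

theorem isOpen_rectangle (b : OrthonormalBasis (Fin 2) ℝ Plane) {I J : Set ℝ} (hI : IsOpen I)
    (hJ : IsOpen J) : IsOpen (rectangle b I J) :=
  (hI.preimage (by fun_prop)).inter (hJ.preimage (by fun_prop))

theorem perimeter_rectangle_le (b : OrthonormalBasis (Fin 2) ℝ Plane) {α β γ δ : ℝ}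
    (hαβ : α ≤ β) (hγδ : γ ≤ δ) :
    perimeter (rectangle b (Ioo α β) (Ioo γ δ)) ≤
      ENNReal.ofReal (2 * (β - α) + 2 * (δ - γ)) := by
  let P : ℝ → ℝ → Plane := fun s t => s • b 0 + t • b 1
  have hclosed : IsClosed {x : Plane | inner ℝ (b 0) x ∈ Icc α β ∧ inner ℝ (b 1) x ∈ Icc γ δ} :=
    (isClosed_Icc.preimage (by fun_prop)).inter (isClosed_Icc.preimage (by fun_prop))
  have hparam : ∀ {u v w : ℝ}, w ∈ Icc u v → ∃ θ ∈ Icc (0 : ℝ) 1, (1 - θ) * u + θ * v = w := by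
    intro u v w hw
    have : w ∈ segment ℝ u v := by rwa [segment_eq_Icc (hw.1.trans hw.2)]
    rw [segment_eq_image] at this
    simpa using this
  have hhor : ∀ {x : Plane} {t}, inner ℝ (b 0) x ∈ Icc α β → inner ℝ (b 1) x = t →
      x ∈ segment ℝ (P α t) (P β t) := by
    intro x t hx ht
    obtain ⟨θ, hθ, h⟩ := hparam hx
    rw [segment_eq_image]
    refine ⟨θ, hθ, ?_⟩
    rw [eq_inner_smul_add b x, ← h, ht]
    simp only [P]
    module
  have hver : ∀ {x : Plane} {s}, inner ℝ (b 1) x ∈ Icc γ δ → inner ℝ (b 0) x = s →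
      x ∈ segment ℝ (P s γ) (P s δ) := by
    intro x s hx hs
    obtain ⟨θ, hθ, h⟩ := hparam hx
    rw [segment_eq_image]
    refine ⟨θ, hθ, ?_⟩
    rw [eq_inner_smul_add b x, ← h, hs]
    simp only [P]
    module
  have hcover : frontier (rectangle b (Ioo α β) (Ioo γ δ)) ⊆
      (segment ℝ (P α γ) (P β γ) ∪ segment ℝ (P α δ) (P β δ)) ∪
        (segment ℝ (P α γ) (P α δ) ∪ segment ℝ (P β γ) (P β δ)) := by
    rw [(isOpen_rectangle b isOpen_Ioo isOpen_Ioo).frontier_eq]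
    rintro x ⟨hx, hxo⟩
    have hsub : rectangle b (Ioo α β) (Ioo γ δ) ⊆
        {x : Plane | inner ℝ (b 0) x ∈ Icc α β ∧ inner ℝ (b 1) x ∈ Icc γ δ} :=
      fun y hy => ⟨Ioo_subset_Icc_self hy.1, Ioo_subset_Icc_self hy.2⟩
    obtain ⟨h0, h1⟩ := closure_minimal hsub hclosed hx
    by_cases hγ : inner ℝ (b 1) x = γ
    · exact Or.inl (Or.inl (hhor h0 hγ))
    by_cases hδ : inner ℝ (b 1) x = δ
    · exact Or.inl (Or.inr (hhor h0 hδ))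
    by_cases hα : inner ℝ (b 0) x = α
    · exact Or.inr (Or.inl (hver h1 hα))
    by_cases hβ : inner ℝ (b 0) x = β
    · exact Or.inr (Or.inr (hver h1 hβ))
    exact (hxo ⟨⟨h0.1.lt_of_ne' hα, h0.2.lt_of_ne hβ⟩,
      ⟨h1.1.lt_of_ne' hγ, h1.2.lt_of_ne hδ⟩⟩).elim
  have hlen0 : ∀ t, edist (P α t) (P β t) = ENNReal.ofReal (β - α) := by
    intro t
    have : P β t - P α t = (β - α) • b 0 := by simp only [P]; module
    rw [edist_comm, edist_dist, dist_eq_norm, this, norm_smul, b.norm_eq_one, mul_one,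
      Real.norm_eq_abs, abs_of_nonneg (by linarith)]
  have hlen1 : ∀ s, edist (P s γ) (P s δ) = ENNReal.ofReal (δ - γ) := by
    intro s
    have : P s δ - P s γ = (δ - γ) • b 1 := by simp only [P]; module
    rw [edist_comm, edist_dist, dist_eq_norm, this, norm_smul, b.norm_eq_one, mul_one,
      Real.norm_eq_abs, abs_of_nonneg (by linarith)]
  calc perimeter (rectangle b (Ioo α β) (Ioo γ δ)) ≤ _ := measure_mono hcover
    _ ≤ _ := measure_union_le _ _
    _ ≤ _ := add_le_add (measure_union_le _ _) (measure_union_le _ _)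
    _ = ENNReal.ofReal (2 * (β - α) + 2 * (δ - γ)) := by
      simp only [hausdorffMeasure_segment, hlen0, hlen1]
      rw [← ENNReal.ofReal_add (by linarith) (by linarith),
        ← ENNReal.ofReal_add (by linarith) (by linarith),
        ← ENNReal.ofReal_add (by linarith) (by linarith)]
      congr 1
      ring

/-! ### Integration over the sections of a plane domain -/

/-- The length of the section of `Ω` by the line on which the coordinate along `b 0` is `t`. -/
noncomputable def sectionLength (b : OrthonormalBasis (Fin 2) ℝ Plane) (Ω : Set Plane) (t : ℝ) : ℝ :=
  volume.real {s : ℝ | t • b 0 + s • b 1 ∈ Ω}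

theorem measurableSet_coords {b : OrthonormalBasis (Fin 2) ℝ Plane} {Ω : Set Plane}
    (ho : IsOpen Ω) : MeasurableSet {p : ℝ × ℝ | p.1 • b 0 + p.2 • b 1 ∈ Ω} :=
  (ho.preimage (by fun_prop)).measurableSet

theorem measurable_sectionLength (b : OrthonormalBasis (Fin 2) ℝ Plane) {Ω : Set Plane}
    (ho : IsOpen Ω) : Measurable (sectionLength b Ω) :=
  (measurable_measure_prodMk_left (ν := volume) (measurableSet_coords (b := b) ho)).ennreal_toReal

theorem sectionLength_nonneg (b : OrthonormalBasis (Fin 2) ℝ Plane) (Ω : Set Plane) (t : ℝ) :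
    0 ≤ sectionLength b Ω t := measureReal_nonneg

section Strip

variable {b : OrthonormalBasis (Fin 2) ℝ Plane} {Ω : Set Plane} {γ δ : ℝ}

theorem section_subset_Ioo (hJ : ∀ x ∈ Ω, inner ℝ (b 1) x ∈ Ioo γ δ) (t : ℝ) :
    {s : ℝ | t • b 0 + s • b 1 ∈ Ω} ⊆ Ioo γ δ := fun s hs => by
  simpa only [(inner_basis_smul_add b t s).2] using hJ _ hs

theorem ofReal_sectionLength (hJ : ∀ x ∈ Ω, inner ℝ (b 1) x ∈ Ioo γ δ) (t : ℝ) :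
    ENNReal.ofReal (sectionLength b Ω t) = volume {s : ℝ | t • b 0 + s • b 1 ∈ Ω} :=
  ofReal_measureReal (measure_ne_top_of_subset (section_subset_Ioo hJ t) measure_Ioo_lt_top.ne)

theorem sectionLength_le (hγδ : γ ≤ δ) (hJ : ∀ x ∈ Ω, inner ℝ (b 1) x ∈ Ioo γ δ) (t : ℝ) :
    sectionLength b Ω t ≤ δ - γ := by
  refine (measureReal_mono (section_subset_Ioo hJ t) measure_Ioo_lt_top.ne).trans_eq ?_
  rw [Real.volume_real_Ioo_of_le hγδ]

theorem sectionLength_pos (ho : IsOpen Ω) (hJ : ∀ x ∈ Ω, inner ℝ (b 1) x ∈ Ioo γ δ) {t : ℝ}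
    (ht : t ∈ (fun x => inner ℝ (b 0) x) '' Ω) : 0 < sectionLength b Ω t := by
  obtain ⟨x, hx, rfl⟩ := ht
  rw [← ENNReal.ofReal_pos, ofReal_sectionLength hJ]
  refine (ho.preimage (by fun_prop)).measure_pos volume ⟨inner ℝ (b 1) x, ?_⟩
  rw [mem_preimage, ← eq_inner_smul_add]
  exact hx

theorem sectionLength_eq_zero {t : ℝ} (ht : t ∉ (fun x => inner ℝ (b 0) x) '' Ω) :
    sectionLength b Ω t = 0 := by
  have : {s : ℝ | t • b 0 + s • b 1 ∈ Ω} = ∅ := by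
    refine eq_empty_of_forall_notMem fun s hs => ht ⟨_, hs, (inner_basis_smul_add b t s).1⟩
  rw [sectionLength, this, measureReal_empty]

/-- Fubini's theorem: the coordinate along `b 0` pushes the area of `Ω` forward to the measure
whose density is the section length. -/
theorem map_inner_restrict (ho : IsOpen Ω) (hJ : ∀ x ∈ Ω, inner ℝ (b 1) x ∈ Ioo γ δ) :
    (volume.restrict Ω).map (fun x => (inner ℝ (b 0) x : ℝ)) =
      volume.withDensity fun t => ENNReal.ofReal (sectionLength b Ω t) := by
  ext B hB
  have hinner : Measurable fun x : Plane => (inner ℝ (b 0) x : ℝ) := by fun_prop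
  have hset : (fun x => (inner ℝ (b 0) x : ℝ)) ⁻¹' B ∩ Ω =
      (fun x : Plane => ((inner ℝ (b 0) x : ℝ), (inner ℝ (b 1) x : ℝ))) ⁻¹'
        (Prod.fst ⁻¹' B ∩ {p : ℝ × ℝ | p.1 • b 0 + p.2 • b 1 ∈ Ω}) := by
    ext x
    simp only [mem_inter_iff, mem_preimage, mem_ofPred_eq, ← eq_inner_smul_add]
  have hm := (measurable_fst hB).inter (measurableSet_coords (b := b) ho)
  rw [Measure.map_apply hinner hB, Measure.restrict_apply (hinner hB), hset,
    (measurePreserving_orthonormalCoords b).measure_preimage hm.nullMeasurableSet,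
    Measure.volume_eq_prod, Measure.prod_apply hm, withDensity_apply _ hB,
    ← lintegral_indicator hB]
  refine lintegral_congr fun t => ?_
  by_cases ht : t ∈ B
  · rw [indicator_of_mem ht, ofReal_sectionLength hJ]
    congr 1
    ext s
    simp [ht]
  · rw [indicator_of_notMem ht]
    convert measure_empty (μ := volume)
    ext s
    simp [ht]

theorem setIntegral_comp_inner (ho : IsOpen Ω) (hJ : ∀ x ∈ Ω, inner ℝ (b 1) x ∈ Ioo γ δ)
    {α β : ℝ} (hαβ : α ≤ β) (hI : (fun x => inner ℝ (b 0) x) '' Ω = Ioo α β) {f : ℝ → ℝ}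
    (hf : Measurable f) :
    ∫ x in Ω, f (inner ℝ (b 0) x) = ∫ t in α..β, f t * sectionLength b Ω t := by
  have hinner : Measurable fun x : Plane => (inner ℝ (b 0) x : ℝ) := by fun_prop
  rw [← integral_map (f := f) hinner.aemeasurable hf.aestronglyMeasurable,
    map_inner_restrict ho hJ, integral_withDensity_eq_integral_toReal_smul
      (measurable_sectionLength b ho).ennreal_ofReal (by simp),
    intervalIntegral.integral_of_le hαβ, integral_Ioc_eq_integral_Ioo,
    setIntegral_eq_integral_of_forall_compl_eq_zero]
  · refine integral_congr_ae (Eventually.of_forall fun t => ?_)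
    simp only [ENNReal.toReal_ofReal (sectionLength_nonneg b Ω t), smul_eq_mul, mul_comm]
  · intro t ht
    rw [sectionLength_eq_zero (hI ▸ ht), mul_zero]

theorem setLIntegral_ofReal_comp_inner (ho : IsOpen Ω) (hv : volume Ω ≠ ⊤)
    (hJ : ∀ x ∈ Ω, inner ℝ (b 1) x ∈ Ioo γ δ)
    {α β : ℝ} (hαβ : α ≤ β) (hI : (fun x => inner ℝ (b 0) x) '' Ω = Ioo α β) {f : ℝ → ℝ}
    (hf : Measurable f) (hf0 : ∀ t, 0 ≤ f t) {C : ℝ} (hC : ∀ t, f t ≤ C) :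
    ∫⁻ x in Ω, ENNReal.ofReal (f (inner ℝ (b 0) x)) =
      ENNReal.ofReal (∫ t in α..β, f t * sectionLength b Ω t) := by
  have hinner : Measurable fun x : Plane => (inner ℝ (b 0) x : ℝ) := by fun_prop
  rw [← setIntegral_comp_inner ho hJ hαβ hI hf, ofReal_integral_eq_lintegral_ofReal]
  · refine Measure.integrableOn_of_bounded (M := C) hv (hf.comp hinner).aestronglyMeasurable ?_
    refine Eventually.of_forall fun x => ?_
    rw [Real.norm_of_nonneg (hf0 _)]
    exact hC _
  · exact Eventually.of_forall fun x => hf0 _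

end Strip

/-! ### Sobolev functions of one coordinate -/

theorem isSobolevPair_comp_inner (b : OrthonormalBasis (Fin 2) ℝ Plane) {Ω : Set Plane}
    (hv : volume Ω ≠ ⊤) {W W' : ℝ → ℝ} {K : NNReal} (hW : LipschitzWith K W)
    (hW' : Measurable W') (hd : ∀ᵐ t, HasDerivAt W (W' t) t) {C C' : ℝ} (hC : ∀ t, |W t| ≤ C)
    (hC' : ∀ t, |W' t| ≤ C') :
    IsSobolevPair Ω (fun x => W (inner ℝ (b 0) x)) (fun x => W' (inner ℝ (b 0) x) • b 0) := by
  have hinner : Measurable fun x : Plane => (inner ℝ (b 0) x : ℝ) := by fun_prop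
  have hfin : IsFiniteMeasure (volume.restrict Ω) := ⟨by simpa using hv.lt_top⟩
  have hlip : LipschitzWith 1 fun x : Plane => (inner ℝ (b 0) x : ℝ) := by
    refine LipschitzWith.of_dist_le_mul fun x y => ?_
    rw [Real.dist_eq, ← inner_sub_right, dist_eq_norm]
    simpa [b.norm_eq_one] using abs_real_inner_le_norm (b 0) (x - y)
  have hu : LipschitzWith (K * 1) fun x : Plane => W (inner ℝ (b 0) x) := hW.comp hlip
  refine ⟨?_, ?_, ?_⟩
  · exact MemLp.of_bound hu.continuous.aestronglyMeasurable C (Eventually.of_forall fun x => hC _)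
  · refine MemLp.of_bound ((hW'.comp hinner).smul_const (b 0)).aestronglyMeasurable C'
      (Eventually.of_forall fun x => ?_)
    rw [norm_smul, b.norm_eq_one, mul_one]
    exact hC' _
  · intro φ hφ hφc hφs v
    obtain ⟨D, hD⟩ := hφ.lipschitzWith_of_hasCompactSupport hφc (by simp)
    have hparts := hu.integral_lineDeriv_mul_eq (μ := volume) hD hφc v
    have hqmp : Measure.QuasiMeasurePreserving (fun x : Plane => (inner ℝ (b 0) x : ℝ)) :=
      Measure.quasiMeasurePreserving_fst.comp
        (measurePreserving_orthonormalCoords b).quasiMeasurePreserving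
    have hline : ∀ᵐ x : Plane, lineDeriv ℝ (fun x : Plane => W (inner ℝ (b 0) x)) x v =
        inner ℝ (W' (inner ℝ (b 0) x) • b 0) v := by
      filter_upwards [hqmp.ae hd] with x hx
      rw [real_inner_smul_left]
      have h1 : HasDerivAt (fun t : ℝ => (inner ℝ (b 0) (x + t • v) : ℝ)) (inner ℝ (b 0) v) 0 := by
        simp only [inner_add_right, inner_smul_right]
        simpa using ((hasDerivAt_id (0 : ℝ)).mul_const (inner ℝ (b 0) v : ℝ)).const_add
          (inner ℝ (b 0) x : ℝ)
      have hx' : HasDerivAt W (W' (inner ℝ (b 0) x)) (inner ℝ (b 0) (x + (0 : ℝ) • v)) := by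
        simpa using hx
      exact (hx'.comp (0 : ℝ) h1).deriv
    have hleft : ∫ x in Ω, W (inner ℝ (b 0) x) * fderiv ℝ φ x v =
        ∫ x, W (inner ℝ (b 0) x) * fderiv ℝ φ x v := by
      refine setIntegral_eq_integral_of_forall_compl_eq_zero fun x hx => ?_
      rw [fderiv_of_notMem_tsupport (𝕜 := ℝ) fun h => hx (hφs h)]
      simp
    have hright : ∫ x in Ω, inner ℝ (W' (inner ℝ (b 0) x) • b 0) v * φ x =
        ∫ x, inner ℝ (W' (inner ℝ (b 0) x) • b 0) v * φ x := by
      refine setIntegral_eq_integral_of_forall_compl_eq_zero fun x hx => ?_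
      rw [image_eq_zero_of_notMem_tsupport fun h => hx (hφs h), mul_zero]
    rw [hleft, hright]
    have hcongr : ∫ x, inner ℝ (W' (inner ℝ (b 0) x) • b 0) v * φ x =
        ∫ x, lineDeriv ℝ (fun x : Plane => W (inner ℝ (b 0) x)) x v * φ x := by
      refine integral_congr_ae ?_
      filter_upwards [hline] with x hx
      rw [hx]
    rw [hcongr, hparts, ← integral_neg]
    refine integral_congr_ae (Eventually.of_forall fun x => ?_)
    simp only [(hφ.differentiable (by simp) x).lineDeriv_eq_fderiv, map_neg]
    ring

/-! ### Trigonometric functions of a Lipschitz primitive -/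

section Primitive

variable {ℓ : ℝ → ℝ} {h α β : ℝ}

theorem locallyIntegrable_of_bounded (hm : Measurable ℓ) (h0 : ∀ t, 0 ≤ ℓ t) (hh : ∀ t, ℓ t ≤ h) :
    LocallyIntegrable ℓ :=
  (locallyIntegrable_const h).mono hm.aestronglyMeasurable (Eventually.of_forall fun t => by
    rw [Real.norm_of_nonneg (h0 t), Real.norm_of_nonneg ((h0 t).trans (hh t))]
    exact hh t)

theorem intervalIntegrable_of_bounded (hm : Measurable ℓ) (h0 : ∀ t, 0 ≤ ℓ t)
    (hh : ∀ t, ℓ t ≤ h) (u v : ℝ) : IntervalIntegrable ℓ volume u v :=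
  (locallyIntegrable_of_bounded hm h0 hh).integrableOn_isCompact isCompact_uIcc
    |>.intervalIntegrable

theorem lipschitzWith_primitive (hm : Measurable ℓ) (h0 : ∀ t, 0 ≤ ℓ t) (hh : ∀ t, ℓ t ≤ h) :
    LipschitzWith h.toNNReal fun t => ∫ s in α..t, ℓ s := by
  refine LipschitzWith.of_dist_le_mul fun u v => ?_
  rw [Real.dist_eq, intervalIntegral.integral_interval_sub_left
    (intervalIntegrable_of_bounded hm h0 hh _ _) (intervalIntegrable_of_bounded hm h0 hh _ _),
    Real.dist_eq, Real.coe_toNNReal _ ((h0 0).trans (hh 0)), ← Real.norm_eq_abs]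
  refine intervalIntegral.norm_integral_le_of_norm_le_const fun t _ => ?_
  rw [Real.norm_of_nonneg (h0 t)]
  exact hh t

/-- The substitution `y = F t`, where `F` is the primitive of `ℓ`, in the integral of `cos (k y)`
over a multiple of half a period. -/
theorem integral_cos_primitive_mul (hm : Measurable ℓ) (h0 : ∀ t, 0 ≤ ℓ t) (hh : ∀ t, ℓ t ≤ h)
    {k : ℝ} (hk : k ≠ 0) (hsin : Real.sin (k * ∫ s in α..β, ℓ s) = 0) :
    ∫ t in α..β, Real.cos (k * ∫ s in α..t, ℓ s) * ℓ t = 0 := by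
  have hlip : LipschitzWith (1 * (‖k‖₊ * h.toNNReal))
      fun t => Real.sin (k * ∫ s in α..t, ℓ s) :=
    Real.lipschitzWith_sin.comp ((lipschitzWith_smul k).comp (lipschitzWith_primitive hm h0 hh))
  have hftc := (hlip.lipschitzOnWith (s := uIcc α β)).absolutelyContinuousOnInterval
    |>.integral_deriv_eq_sub
  simp only [hsin, intervalIntegral.integral_same, mul_zero, Real.sin_zero, sub_zero] at hftc
  have hcongr : ∫ t in α..β, deriv (fun t => Real.sin (k * ∫ s in α..t, ℓ s)) t =
      ∫ t in α..β, k * (Real.cos (k * ∫ s in α..t, ℓ s) * ℓ t) := by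
    refine intervalIntegral.integral_congr_ae ?_
    filter_upwards [LocallyIntegrable.ae_hasDerivAt_integral
      (locallyIntegrable_of_bounded hm h0 hh)] with t ht _
    rw [((ht α).const_mul k).sin.deriv]
    ring
  rw [hcongr, intervalIntegral.integral_const_mul] at hftc
  exact (mul_eq_zero.1 hftc).resolve_left hk

theorem intervalIntegrable_mul_of_bounded (hm : Measurable ℓ) (h0 : ∀ t, 0 ≤ ℓ t)
    (hh : ∀ t, ℓ t ≤ h) {f : ℝ → ℝ} (hf : Continuous f) (u v : ℝ) :
    IntervalIntegrable (fun t => f t * ℓ t) volume u v :=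
  (intervalIntegrable_of_bounded hm h0 hh u v).continuousOn_mul hf.continuousOn

theorem integral_cos_sq_primitive_mul (hm : Measurable ℓ) (h0 : ∀ t, 0 ≤ ℓ t) (hh : ∀ t, ℓ t ≤ h)
    {k : ℝ} (hk : k ≠ 0) (hsin : Real.sin (2 * k * ∫ s in α..β, ℓ s) = 0) :
    ∫ t in α..β, Real.cos (k * ∫ s in α..t, ℓ s) ^ 2 * ℓ t = (∫ s in α..β, ℓ s) / 2 := by
  have hcont : Continuous fun t => Real.cos (2 * k * ∫ s in α..t, ℓ s) :=
    Real.continuous_cos.comp (continuous_const.mul (lipschitzWith_primitive hm h0 hh).continuous)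
  have h1 : ∀ t, Real.cos (k * ∫ s in α..t, ℓ s) ^ 2 * ℓ t =
      (1 / 2) * ℓ t + (1 / 2) * (Real.cos (2 * k * ∫ s in α..t, ℓ s) * ℓ t) := by
    intro t
    rw [Real.cos_sq, mul_assoc 2 k]
    ring
  simp only [h1]
  rw [intervalIntegral.integral_add
    ((intervalIntegrable_of_bounded hm h0 hh _ _).const_mul _)
    ((intervalIntegrable_mul_of_bounded hm h0 hh hcont _ _).const_mul _),
    intervalIntegral.integral_const_mul, intervalIntegral.integral_const_mul,
    integral_cos_primitive_mul hm h0 hh (mul_ne_zero two_ne_zero hk) hsin]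
  ring

theorem integral_sin_sq_primitive_mul (hm : Measurable ℓ) (h0 : ∀ t, 0 ≤ ℓ t) (hh : ∀ t, ℓ t ≤ h)
    {k : ℝ} (hk : k ≠ 0) (hsin : Real.sin (2 * k * ∫ s in α..β, ℓ s) = 0) :
    ∫ t in α..β, Real.sin (k * ∫ s in α..t, ℓ s) ^ 2 * ℓ t = (∫ s in α..β, ℓ s) / 2 := by
  have hcont : Continuous fun t => Real.cos (k * ∫ s in α..t, ℓ s) ^ 2 :=
    (Real.continuous_cos.comp
      (continuous_const.mul (lipschitzWith_primitive hm h0 hh).continuous)).pow 2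
  have h1 : ∀ t, Real.sin (k * ∫ s in α..t, ℓ s) ^ 2 * ℓ t =
      ℓ t - Real.cos (k * ∫ s in α..t, ℓ s) ^ 2 * ℓ t := by
    intro t
    rw [Real.sin_sq]
    ring
  simp only [h1]
  rw [intervalIntegral.integral_sub (intervalIntegrable_of_bounded hm h0 hh _ _)
    (intervalIntegrable_mul_of_bounded hm h0 hh hcont _ _),
    integral_cos_sq_primitive_mul hm h0 hh hk hsin]
  ring

/-- The equality case of `∫ sin² (k F) ℓ³ ≤ h² ∫ sin² (k F) ℓ`: the weight `ℓ` is constant, because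
`sin (k F)` does not vanish in the interior of the interval. -/
theorem integral_eq_of_le_integral_sin_sq (hm : Measurable ℓ) (h0 : ∀ t, 0 ≤ ℓ t)
    (hh : ∀ t, ℓ t ≤ h) (hαβ : α < β) (hpos : ∀ t ∈ Ioo α β, 0 < ℓ t) {A : ℝ}
    (hA : ∫ s in α..β, ℓ s = A)
    (hle : h ^ 2 * (A / 2) ≤
      ∫ t in α..β, Real.sin (Real.pi / A * ∫ s in α..t, ℓ s) ^ 2 * ℓ t ^ 2 * ℓ t) :
    A = h * (β - α) := by
  have hint := intervalIntegrable_of_bounded hm h0 hh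
  have hA0 : 0 < A := hA ▸ intervalIntegral.intervalIntegral_pos_of_pos_on (hint _ _) hpos hαβ
  have hk : Real.pi / A ≠ 0 := (div_pos Real.pi_pos hA0).ne'
  have hsin2 : Real.sin (2 * (Real.pi / A) * ∫ s in α..β, ℓ s) = 0 := by
    rw [hA, mul_assoc, div_mul_cancel₀ _ hA0.ne', Real.sin_two_pi]
  have hS := integral_sin_sq_primitive_mul hm h0 hh hk hsin2
  rw [hA] at hS
  have hcont : Continuous fun t => Real.sin (Real.pi / A * ∫ s in α..t, ℓ s) ^ 2 :=
    (Real.continuous_sin.comp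
      (continuous_const.mul (lipschitzWith_primitive hm h0 hh).continuous)).pow 2
  have hm2 : Measurable fun t => ℓ t ^ 2 * ℓ t := (hm.pow_const 2).mul hm
  have hint2 : IntervalIntegrable
      (fun t => Real.sin (Real.pi / A * ∫ s in α..t, ℓ s) ^ 2 * ℓ t ^ 2 * ℓ t) volume α β := by
    simp only [mul_assoc]
    refine intervalIntegrable_mul_of_bounded (h := h ^ 2 * h) hm2
      (fun t => mul_nonneg (sq_nonneg _) (h0 t)) (fun t => ?_) hcont α β
    exact mul_le_mul (pow_le_pow_left₀ (h0 t) (hh t) 2) (hh t) (h0 t) (sq_nonneg _)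
  have hint1 := (intervalIntegrable_mul_of_bounded hm h0 hh hcont α β).const_mul (h ^ 2)
  let D : ℝ → ℝ := fun t => h ^ 2 * (Real.sin (Real.pi / A * ∫ s in α..t, ℓ s) ^ 2 * ℓ t) -
    Real.sin (Real.pi / A * ∫ s in α..t, ℓ s) ^ 2 * ℓ t ^ 2 * ℓ t
  have hDeq : ∀ t, D t = Real.sin (Real.pi / A * ∫ s in α..t, ℓ s) ^ 2 * ℓ t *
      (h ^ 2 - ℓ t ^ 2) := fun t => by simp only [D]; ring
  have hD0 : ∀ t, 0 ≤ D t := by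
    intro t
    rw [hDeq]
    exact mul_nonneg (mul_nonneg (sq_nonneg _) (h0 t))
      (sub_nonneg.2 (pow_le_pow_left₀ (h0 t) (hh t) 2))
  have hDint : ∫ t in α..β, D t = 0 := by
    refine le_antisymm ?_ (intervalIntegral.integral_nonneg hαβ.le fun t _ => hD0 t)
    rw [intervalIntegral.integral_sub hint1 hint2, intervalIntegral.integral_const_mul, hS]
    linarith
  rw [intervalIntegral.integral_eq_zero_iff_of_le_of_nonneg_ae hαβ.le
    (Eventually.of_forall hD0) (hint1.sub hint2)] at hDint
  rw [← hA, mul_comm, ← smul_eq_mul, ← intervalIntegral.integral_const]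
  refine intervalIntegral.integral_congr_ae ?_
  rw [EventuallyEq, ae_restrict_iff' measurableSet_Ioc] at hDint
  filter_upwards [hDint, Measure.ae_ne volume β] with t ht htβ htI
  rw [uIoc_of_le hαβ.le] at htI
  have hzero : D t = 0 := ht htI
  have htI' : t ∈ Ioo α β := ⟨htI.1, htI.2.lt_of_ne htβ⟩
  have hF0 : 0 < ∫ s in α..t, ℓ s := intervalIntegral.intervalIntegral_pos_of_pos_on (hint _ _)
    (fun s hs => hpos s ⟨hs.1, hs.2.trans htI'.2⟩) htI'.1
  have hF1 : 0 < ∫ s in t..β, ℓ s := intervalIntegral.intervalIntegral_pos_of_pos_on (hint _ _)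
    (fun s hs => hpos s ⟨htI'.1.trans hs.1, hs.2⟩) htI'.2
  have hF2 : ∫ s in α..t, ℓ s < A := by
    rw [← hA, ← intervalIntegral.integral_add_adjacent_intervals (hint α t) (hint t β)]
    linarith
  have hsin : 0 < Real.sin (Real.pi / A * ∫ s in α..t, ℓ s) := by
    refine Real.sin_pos_of_pos_of_lt_pi (by positivity) ?_
    rw [div_mul_eq_mul_div, div_lt_iff₀ hA0]
    exact mul_lt_mul_of_pos_left hF2 Real.pi_pos
  have hℓ := hpos t htI'
  rw [hDeq, mul_eq_zero] at hzero
  have h3 := hzero.resolve_left (by positivity)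
  nlinarith [hh t]

end Primitive

/-! ### The upper bound for the first Neumann eigenvalue -/

theorem image_inner_eq_Ioo {Ω : Set Plane} (hΩ : IsConvexDomain Ω)
    (b : OrthonormalBasis (Fin 2) ℝ Plane) (i : Fin 2) :
    ∃ α β, α < β ∧ (fun x : Plane => (inner ℝ (b i) x : ℝ)) '' Ω = Ioo α β := by
  set S := (fun x : Plane => (inner ℝ (b i) x : ℝ)) '' Ω
  have hne : S.Nonempty := hΩ.nonempty.image _
  have hbi : b i ≠ 0 := fun h => by simpa [h] using b.norm_eq_one i
  have hopen : IsOpen S := by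
    refine (innerSL ℝ (b i)).isOpenMap_of_ne_zero (fun h => hbi ?_) Ω hΩ.isOpen
    simpa using congrArg (fun f : Plane →L[ℝ] ℝ => f (b i)) h
  have hconn : IsConnected S :=
    ⟨hne, hΩ.convex.isPreconnected.image _ (by fun_prop)⟩
  obtain ⟨R, hR⟩ := hΩ.isBounded.exists_norm_le
  have habs : ∀ t ∈ S, |t| ≤ R := by
    rintro _ ⟨x, hx, rfl⟩
    refine (abs_real_inner_le_norm _ _).trans ?_
    rw [b.norm_eq_one, one_mul]
    exact hR x hx
  have hbelow : BddBelow S := ⟨-R, fun t ht => (abs_le.1 (habs t ht)).1⟩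
  have habove : BddAbove S := ⟨R, fun t ht => (abs_le.1 (habs t ht)).2⟩
  have heq : S = Ioo (sInf S) (sSup S) := by
    refine Subset.antisymm ?_ (hconn.Ioo_csInf_csSup_subset hbelow habove)
    rw [← interior_Icc]
    exact interior_maximal (subset_Icc_csInf_csSup hbelow habove) hopen
  refine ⟨sInf S, sSup S, ?_, heq⟩
  obtain ⟨t, ht⟩ := hne
  rw [heq] at ht
  exact ht.1.trans ht.2

/-- An open convex set of full measure in an open set is equal to it. -/
theorem Convex.eq_of_subset_of_volume_le {Ω U : Set Plane} (hc : Convex ℝ Ω) (ho : IsOpen Ω)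
    (hne : Ω.Nonempty) (hU : IsOpen U) (hsub : Ω ⊆ U) (hfin : volume Ω ≠ ⊤)
    (hvol : volume U ≤ volume Ω) : Ω = U := by
  have hdiff : volume (U \ closure Ω) = 0 := by
    refine measure_mono_null (sdiff_subset_sdiff_right subset_closure) ?_
    rw [measure_sdiff hsub ho.nullMeasurableSet hfin, tsub_eq_zero_of_le hvol]
  have hempty := ((hU.sdiff isClosed_closure).measure_eq_zero_iff volume).1 hdiff
  refine hsub.antisymm ?_
  have h1 : U ⊆ interior (closure Ω) := interior_maximal (sdiff_eq_empty.1 hempty) hU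
  rwa [hc.interior_closure_eq_interior_of_nonempty_interior (by rwa [ho.interior_eq]),
    ho.interior_eq] at h1

/-- A convex domain contained in a strip of width `δ - γ` satisfies
`μ₁ ≤ π² (δ - γ)² / |Ω|²`, and only the rectangles spanning the strip can attain equality. The test
function is `cos (π F / |Ω|)`, where `F` is the area of the part of `Ω` on one side of a line
perpendicular to the strip. -/
theorem neumannMu1_le_of_strip {Ω : Set Plane} (hΩ : IsConvexDomain Ω)
    (b : OrthonormalBasis (Fin 2) ℝ Plane) {γ δ : ℝ}
    (hJ : ∀ x ∈ Ω, inner ℝ (b 1) x ∈ Ioo γ δ) :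
    neumannMu1 Ω ≤ ENNReal.ofReal ((Real.pi / volume.real Ω) ^ 2 * (δ - γ) ^ 2) ∧
      (ENNReal.ofReal ((Real.pi / volume.real Ω) ^ 2 * (δ - γ) ^ 2) ≤ neumannMu1 Ω →
        ∃ α β, α < β ∧ Ω = rectangle b (Ioo α β) (Ioo γ δ)) := by
  obtain ⟨α, β, hαβ, hI⟩ := image_inner_eq_Ioo hΩ b 0
  have ho := hΩ.isOpen
  have hv : volume Ω ≠ ⊤ := hΩ.isBounded.measure_lt_top.ne
  have hγδ : γ < δ := by
    obtain ⟨x, hx⟩ := hΩ.nonempty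
    exact (hJ x hx).1.trans (hJ x hx).2
  set ℓ := sectionLength b Ω with hℓdef
  set h := δ - γ with hhdef
  set A := volume.real Ω with hAdef
  have hm : Measurable ℓ := measurable_sectionLength b ho
  have h0 : ∀ t, 0 ≤ ℓ t := sectionLength_nonneg b Ω
  have hh : ∀ t, ℓ t ≤ h := sectionLength_le hγδ.le hJ
  have hpos : ∀ t ∈ Ioo α β, 0 < ℓ t := fun t ht => sectionLength_pos ho hJ (hI ▸ ht)
  have hint := intervalIntegrable_of_bounded hm h0 hh
  have hA : ∫ t in α..β, ℓ t = A := by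
    have := setIntegral_comp_inner ho hJ hαβ.le hI (f := fun _ => 1) measurable_const
    simpa using this.symm
  have hA0 : 0 < A := hA ▸ intervalIntegral.intervalIntegral_pos_of_pos_on (hint _ _) hpos hαβ
  set k := Real.pi / A with hkdef
  have hk : 0 < k := div_pos Real.pi_pos hA0
  have hsin : Real.sin (k * ∫ s in α..β, ℓ s) = 0 := by
    rw [hA, div_mul_cancel₀ _ hA0.ne', Real.sin_pi]
  have hsin2 : Real.sin (2 * k * ∫ s in α..β, ℓ s) = 0 := by
    rw [hA, mul_assoc, div_mul_cancel₀ _ hA0.ne', Real.sin_two_pi]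
  have hFlip : LipschitzWith h.toNNReal fun t => ∫ s in α..t, ℓ s :=
    lipschitzWith_primitive hm h0 hh
  set F : ℝ → ℝ := fun t => ∫ s in α..t, ℓ s with hFdef
  have hWlip : LipschitzWith (1 * (‖k‖₊ * h.toNNReal)) fun t => Real.cos (k * F t) :=
    Real.lipschitzWith_cos.comp ((lipschitzWith_smul k).comp hFlip)
  have hFm : Measurable F := hFlip.continuous.measurable
  have hW'm : Measurable fun t => -Real.sin (k * F t) * (k * ℓ t) := by fun_prop
  have hd : ∀ᵐ t, HasDerivAt (fun t => Real.cos (k * F t))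
      (-Real.sin (k * F t) * (k * ℓ t)) t := by
    filter_upwards [LocallyIntegrable.ae_hasDerivAt_integral
      (locallyIntegrable_of_bounded hm h0 hh)] with t ht
    exact ((ht α).const_mul k).cos
  have hW' : ∀ t, |(-Real.sin (k * F t) * (k * ℓ t))| ≤ k * h := by
    intro t
    rw [abs_mul, abs_neg, abs_of_nonneg (mul_nonneg hk.le (h0 t)), ← one_mul (k * h)]
    exact mul_le_mul (Real.abs_sin_le_one _) (mul_le_mul_of_nonneg_left (hh t) hk.le)
      (mul_nonneg hk.le (h0 t)) zero_le_one
  have hpair := isSobolevPair_comp_inner b hv hWlip hW'm hd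
    (fun t => Real.abs_cos_le_one _) hW'
  have hmean : ∫ x in Ω, Real.cos (k * F (inner ℝ (b 0) x)) = 0 := by
    rw [setIntegral_comp_inner ho hJ hαβ.le hI (f := fun t => Real.cos (k * F t)) (by fun_prop)]
    exact integral_cos_primitive_mul hm h0 hh hk.ne' hsin
  have hden : ∫⁻ x in Ω, ‖Real.cos (k * F (inner ℝ (b 0) x))‖ₑ ^ 2 = ENNReal.ofReal (A / 2) := by
    have := setLIntegral_ofReal_comp_inner ho hv hJ hαβ.le hI
      (f := fun t => Real.cos (k * F t) ^ 2) (by fun_prop) (fun t => sq_nonneg _) (C := 1)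
      (fun t => Real.cos_sq_le_one _)
    rw [integral_cos_sq_primitive_mul hm h0 hh hk.ne' hsin2, hA] at this
    rw [← this]
    refine lintegral_congr fun x => ?_
    rw [← ofReal_norm, ← ENNReal.ofReal_pow (norm_nonneg _), Real.norm_eq_abs, sq_abs]
  set N := ∫ t in α..β, Real.sin (k * F t) ^ 2 * ℓ t ^ 2 * ℓ t with hNdef
  have hnum : ∫⁻ x in Ω, ‖(-Real.sin (k * F (inner ℝ (b 0) x)) * (k * ℓ (inner ℝ (b 0) x))) • b 0‖ₑ
      ^ 2 = ENNReal.ofReal (k ^ 2 * N) := by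
    have := setLIntegral_ofReal_comp_inner ho hv hJ hαβ.le hI
      (f := fun t => (-Real.sin (k * F t) * (k * ℓ t)) ^ 2) (by fun_prop) (fun t => sq_nonneg _)
      (C := (k * h) ^ 2) (fun t => by
        rw [← sq_abs]
        exact pow_le_pow_left₀ (abs_nonneg _) (hW' t) 2)
    rw [hNdef, ← intervalIntegral.integral_const_mul]
    convert this using 1
    · refine lintegral_congr fun x => ?_
      rw [← ofReal_norm, ← ENNReal.ofReal_pow (norm_nonneg _), norm_smul,
        b.norm_eq_one, mul_one, Real.norm_eq_abs, sq_abs]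
    · congr 1
      refine intervalIntegral.integral_congr fun t _ => ?_
      ring
  have hN : N ≤ h ^ 2 * (A / 2) := by
    have hS := integral_sin_sq_primitive_mul hm h0 hh hk.ne' hsin2
    rw [hA] at hS
    have hcont : Continuous fun t => Real.sin (k * F t) ^ 2 :=
      (Real.continuous_sin.comp (continuous_const.mul hFlip.continuous)).pow 2
    rw [← hS, ← intervalIntegral.integral_const_mul]
    refine intervalIntegral.integral_mono_on_of_le_Ioo hαβ.le ?_
      ((intervalIntegrable_mul_of_bounded hm h0 hh hcont α β).const_mul (h ^ 2)) fun t _ => ?_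
    · simp only [mul_assoc]
      refine intervalIntegrable_mul_of_bounded (h := h ^ 2 * h) ((hm.pow_const 2).mul hm)
        (fun t => mul_nonneg (sq_nonneg _) (h0 t)) (fun t => ?_) hcont α β
      exact mul_le_mul (pow_le_pow_left₀ (h0 t) (hh t) 2) (hh t) (h0 t) (sq_nonneg _)
    · have := mul_le_mul_of_nonneg_left (pow_le_pow_left₀ (h0 t) (hh t) 2)
        (mul_nonneg (sq_nonneg (Real.sin (k * F t))) (h0 t))
      calc _ = Real.sin (k * F t) ^ 2 * ℓ t * ℓ t ^ 2 := by ring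
        _ ≤ _ := this
        _ = _ := by ring
  have hmu : neumannMu1 Ω ≤ ENNReal.ofReal (k ^ 2 * N / (A / 2)) := by
    refine sInf_le ⟨_, _, hpair, hmean, fun hzero => ?_, ?_⟩
    · have : ∫⁻ x in Ω, ‖Real.cos (k * F (inner ℝ (b 0) x))‖ₑ ^ 2 = 0 := by
        rw [lintegral_congr_ae (g := fun _ => 0), lintegral_zero]
        filter_upwards [hzero] with x hx
        rw [hx]
        simp
      rw [hden, ENNReal.ofReal_eq_zero] at this
      linarith
    · rw [hnum, hden, ENNReal.ofReal_div_of_pos (by positivity)]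
  refine ⟨hmu.trans (ENNReal.ofReal_le_ofReal ?_), fun hge => ⟨α, β, hαβ, ?_⟩⟩
  · rw [div_le_iff₀ (by positivity), mul_assoc]
    exact mul_le_mul_of_nonneg_left hN (sq_nonneg k)
  · have hhpos : 0 < h := sub_pos.2 hγδ
    have hle := hge.trans hmu
    rw [ENNReal.ofReal_le_ofReal_iff', or_iff_left (by
      rw [not_le]; positivity), le_div_iff₀ (by positivity), mul_assoc] at hle
    have hAh := integral_eq_of_le_integral_sin_sq hm h0 hh hαβ hpos hA
      (le_of_mul_le_mul_left hle (by positivity))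
    refine hΩ.convex.eq_of_subset_of_volume_le ho hΩ.nonempty
      (isOpen_rectangle b isOpen_Ioo isOpen_Ioo)
      (fun x hx => ⟨hI ▸ mem_image_of_mem _ hx, hJ x hx⟩) hv ?_
    rw [volume_rectangle, ← ENNReal.ofReal_mul (by linarith), ← ofReal_measureReal hv, mul_comm,
      ← hAdef, hAh]

/-! ### The isoperimetric inequality for the first Neumann eigenvalue -/

theorem mainTheorem4 (Ω : Set Plane) (hΩ : IsConvexDomain Ω)
    (L₁ L₂ : AffineSubspace ℝ Plane)
    (h₁ : IsSymmetryAxis L₁ Ω) (h₂ : IsSymmetryAxis L₂ Ω)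
    (hL : L₁.direction ⟂ L₂.direction) :
    perimeter Ω * minimalWidth Ω ≤ 4 * volume Ω ∧
    perimeter Ω ^ 2 * neumannMu1 Ω ≤ ENNReal.ofReal (16 * Real.pi ^ 2) ∧
    (perimeter Ω ^ 2 * neumannMu1 Ω = ENNReal.ofReal (16 * Real.pi ^ 2) → IsOpenSquare Ω) := by
  obtain ⟨c, hc⟩ := exists_center_of_orthogonal_axes h₁ h₂ hL
  obtain ⟨r, hr, hball, hwidth, ν, hν, hstrip⟩ := exists_ball_subset_and_strip hΩ hc
  obtain ⟨b, hb⟩ : ∃ b : OrthonormalBasis (Fin 2) ℝ Plane, b 1 = ν := by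
    have horth : Orthonormal ℝ (({1} : Set (Fin 2)).domRestrict fun _ => ν) := by
      refine ⟨fun i => hν, fun i j hij => (hij (Subsingleton.elim i j)).elim⟩
    obtain ⟨b, hb⟩ := horth.exists_orthonormalBasis_extension_of_card_eq (by simp)
    exact ⟨b, hb 1 rfl⟩
  subst hb
  have hv : volume Ω ≠ ⊤ := hΩ.isBounded.measure_lt_top.ne
  have hA : 0 < volume.real Ω :=
    ENNReal.toReal_pos (hΩ.isOpen.measure_pos volume hΩ.nonempty).ne' hv
  have hP := perimeter_le_of_ball_subset hΩ hr hball
  rw [← ofReal_measureReal hv, ← ENNReal.ofReal_mul (by positivity)] at hP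
  obtain ⟨hmu, heq⟩ := neumannMu1_le_of_strip hΩ b hstrip
  set A := volume.real Ω
  rw [show inner ℝ (b 1) c + r - (inner ℝ (b 1) c - r) = 2 * r by ring] at hmu heq
  have hprod : ENNReal.ofReal (2 / r * A) ^ 2 *
      ENNReal.ofReal ((Real.pi / A) ^ 2 * (2 * r) ^ 2) = ENNReal.ofReal (16 * Real.pi ^ 2) := by
    rw [← ENNReal.ofReal_pow (by positivity), ← ENNReal.ofReal_mul (by positivity)]
    congr 1
    field_simp
    ring
  refine ⟨?_, ?_, fun hE => ?_⟩
  · rw [hwidth, ← ofReal_measureReal hv, ← ENNReal.ofReal_ofNat 4,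
      ← ENNReal.ofReal_mul (by norm_num)]
    refine (mul_le_mul_left hP _).trans_eq ?_
    rw [← ENNReal.ofReal_mul (by positivity)]
    congr 1
    field_simp
    ring
  · rw [← hprod]
    gcongr
  · have hpos : 0 < ENNReal.ofReal (16 * Real.pi ^ 2) :=
      ENNReal.ofReal_pos.2 (by positivity)
    have hmuge : ENNReal.ofReal ((Real.pi / A) ^ 2 * (2 * r) ^ 2) ≤ neumannMu1 Ω := by
      have h : ENNReal.ofReal (2 / r * A) ^ 2 * ENNReal.ofReal ((Real.pi / A) ^ 2 * (2 * r) ^ 2) ≤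
          ENNReal.ofReal (2 / r * A) ^ 2 * neumannMu1 Ω := by
        rw [hprod, ← hE]
        gcongr
      refine (ENNReal.mul_le_mul_iff_right ?_ (by simp)).1 h
      exact pow_ne_zero 2 (ENNReal.ofReal_pos.2 (by positivity)).ne'
    have hPge : ENNReal.ofReal (2 / r * A) ≤ perimeter Ω := by
      have h : ENNReal.ofReal (2 / r * A) ^ 2 * ENNReal.ofReal ((Real.pi / A) ^ 2 * (2 * r) ^ 2) ≤
          perimeter Ω ^ 2 * ENNReal.ofReal ((Real.pi / A) ^ 2 * (2 * r) ^ 2) := by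
        rw [hprod, ← hE]
        gcongr
      have h2 := (ENNReal.mul_le_mul_iff_left
        (ENNReal.ofReal_pos.2 (by positivity)).ne' ENNReal.ofReal_ne_top).1 h
      exact (ENNReal.pow_le_pow_left_iff two_ne_zero).1 h2
    obtain ⟨α, β, hαβ, hrect⟩ := heq hmuge
    have hAeq : A = (β - α) * (2 * r) := by
      have h := volume_rectangle b α β (inner ℝ (b 1) c - r) (inner ℝ (b 1) c + r)
      rw [← hrect, ← ofReal_measureReal hv, ← ENNReal.ofReal_mul (by linarith),
        ENNReal.ofReal_eq_ofReal_iff hA.le (by nlinarith)] at h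
      rw [h]
      ring
    -- Comparing perimeters shows that the side `β - α` is at most the width `2 * r`.
    have hside : β - α ≤ 2 * r := by
      have h := perimeter_rectangle_le b hαβ.le
        (show inner ℝ (b 1) c - r ≤ inner ℝ (b 1) c + r by linarith)
      rw [← hrect] at h
      have h2 := hPge.trans h
      rw [ENNReal.ofReal_le_ofReal_iff (by linarith), hAeq] at h2
      have h3 : 2 / r * ((β - α) * (2 * r)) = 4 * (β - α) := by
        field_simp
        ring
      linarith
    -- The projection `(α, β)` contains that of the ball, hence is equal to it.
    have hmem : ∀ t, |t| < r → inner ℝ (b 0) c + t ∈ Ioo α β := by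
      intro t ht
      have hx : c + t • b 0 ∈ Ω := hball (by
        rw [Metric.mem_ball, dist_eq_norm, add_sub_cancel_left, norm_smul, b.norm_eq_one, mul_one]
        exact ht)
      rw [hrect] at hx
      have := hx.1
      rwa [inner_add_right, inner_smul_right, real_inner_self_eq_norm_sq, b.norm_eq_one, one_pow,
        mul_one] at this
    have hmid := hmem 0 (by simpa using hr)
    rw [add_zero] at hmid
    have hα : α ≤ inner ℝ (b 0) c - r := by
      by_contra! hcon
      have h := hmem (α - inner ℝ (b 0) c) (abs_lt.2 ⟨by linarith, by linarith [hmid.1]⟩)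
      rw [add_sub_cancel] at h
      exact lt_irrefl _ h.1
    have hβ : inner ℝ (b 0) c + r ≤ β := by
      by_contra! hcon
      have h := hmem (β - inner ℝ (b 0) c) (abs_lt.2 ⟨by linarith [hmid.2], by linarith⟩)
      rw [add_sub_cancel] at h
      exact lt_irrefl _ h.2
    refine ⟨c, b, r, hr, ?_⟩
    rw [hrect]
    ext x
    rw [show β = inner ℝ (b 0) c + r by linarith, show α = inner ℝ (b 0) c - r by linarith]
    simp only [rectangle, mem_ofPred_eq, Fin.forall_fin_two, inner_sub_right, abs_sub_lt_iff,
      mem_Ioo]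
    constructor
    · rintro ⟨⟨_, _⟩, _, _⟩
      refine ⟨⟨?_, ?_⟩, ?_, ?_⟩ <;> linarith
    · rintro ⟨⟨_, _⟩, _, _⟩
      refine ⟨⟨?_, ?_⟩, ?_, ?_⟩ <;> linarith
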